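/- Let $\Gamma$ be a finite extensive-form game with perfect recall, with finite player set $N$ and a chance player $c$ having fixed move probabilities. For a player $i$, let $M_i$ index the information sets $I_i^j$, let $A(I_i^j)$ be the set of actions at $I_i^j$, let $W^i$ be the finite set of sequences (sets of moves of player $i$ along some history, including $\emptyset$), and let $\varpi^i_{I_i^j}$ be the sequence leading to $I_i^j$ and $\varpi^i_{I_i^j}a$ its extension by $a\in A(I_i^j)$. Every nonempty sequence is of this last form. A realization plan of $i$ is a function $\gamma^i\ge 0$ on $W^i$ with $\gamma^i(\emptyset)=1$ and $\sum_{a\in A(I_i^j)}\gamma^i(\varpi^i_{I_i^j}a)=\gamma^i(\varpi^i_{I_i^j})$ for all $j\in M_i$. Let $\Lambda^i$ be the set of these and $\Lambda=\prod_{i\in N}\Lambda^i$; $\gamma\in\Lambda$ is positive if all $\gamma^i(\varpi^i)>0$. The realization plan $\gamma^c$ of chance assigns to a sequence of chance moves the product of their probabilities. For a profile $\varpi$ of sequences of all players and chance let $g^i(\varpi)$ be the payoff of $i$ at the terminal history whose moves form $\varpi$, and $0$ if there is none; put $$g^i(\varpi^i,\gamma^{-i})=\sum_{\varpi^{-i}}g^i(\varpi^i,\varpi^{-i})\prod_{p\in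 (N\cup\{c\})\setminus\{i\}}\gamma^p(\varpi^p),\qquad g^i(\tilde\gamma^i,\gamma^{-i})=\sum_{\varpi^i\in W^i}\tilde\gamma^i(\varpi^i)\,g^i(\varpi^i,\gamma^{-i}),$$ $$g^i_m(\varpi^i,\gamma^{-i})=\max\{g^i(\tilde\gamma^i,\gamma^{-i}) : \tilde\gamma^i\in\Lambda^i,\ \tilde\gamma^i(\varpi^i)=1\}.$$ **Definition A.** For $\varepsilon>0$, a positive $\gamma\in\Lambda$ is an $\varepsilon$-sequence-form proper equilibrium (A) if for all $i\in N$ and $\varpi^i,\tilde\varpi^i\in W^i$ with $g^i_m(\varpi^i,\gamma^{-i})<g^i_m(\tilde\varpi^i,\gamma^{-i})$ one has $\gamma^i(\varpi^i)\le\varepsilon\,\gamma^i(\tilde\varpi^i)$. A profile $\gamma^*\in\Lambda$ is a sequence-form proper equilibrium (A) if it is a limit point of a sequence $\gamma(\varepsilon^k)$ of $\varepsilon^k$-sequence-form proper equilibria (A) with $\varepsilon^k>0$ and $\varepsilon^k\to0$. **Definition B.** Let $\kappa_i(\varpi^i)=1+\sum_{j\in M_i:\ \varpi^i\subseteq\varpi^i_{I_i^j}}(|A(I_i^j)|-1)$.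 Let $\mathcal E^i$ consist of all nonempty sets $E\subseteq W^i\setminus\{\emptyset\}$ such that $\{\varpi^i_{I_i^j}a:a\in A(I_i^j)\}\not\subseteq E$ for every $j\in M_i$ and no element of $E$ is properly contained in another one; put $q^i(E)=\sum_{\varpi^i\in E}\kappa_i(\varpi^i)$. For a vector $\delta=(\delta^i_l)$, $i\in N$, $1\le l\le\kappa_i(\emptyset)$, of positive numbers, let $r^i_l(\delta)=\prod_{q=1}^{\kappa_i(\emptyset)-l}\delta^i_q$ and $$\Lambda^i(\delta)=\Big\{\gamma^i\in\Lambda^i : \sum_{\varpi^i\in E}\gamma^i(\varpi^i)\ \ge\ \sum_{q=1}^{q^i(E)}r^i_q(\delta)\ \text{ for all }E\in\mathcal E^i\Big\}.$$ A profile $\gamma$ is a Nash equilibrium of the perturbed sequence-form game $\Gamma_s(\delta)$ if, for every $i\in N$, $\gamma^i$ maximizes $\sum_{j\in M_i}\sum_{a\in A(I_i^j)}\tilde\gamma^i(\varpi^i_{I_i^j}a)\,g^i(\varpi^i_{I_i^j}a,\gamma^{-i})$ over $\tilde\gamma^i\in\Lambda^i(\delta)$. For $\varepsilon>0$, a positive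 $\gamma\in\Lambda$ is an $\varepsilon$-sequence-form proper equilibrium (B) if it is a Nash equilibrium of $\Gamma_s(\delta)$ for some $\delta$ with $0<\delta^i_l\le\varepsilon$ for all $i,l$. A profile $\gamma^*\in\Lambda$ is a sequence-form proper equilibrium (B) if it is the limit of a sequence $\gamma(\varepsilon^k)$ of $\varepsilon^k$-sequence-form proper equilibria (B) with $\varepsilon^k>0$ and $\varepsilon^k\to0$. **Theorem.** A realization plan profile $\gamma^*\in\Lambda$ is a sequence-form proper equilibrium in the sense of Definition A if and only if it is one in the sense of Definition B. -/

import Mathlib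

open Filter Topology

noncomputable section

/-- A finite tree of histories (finite lists of actions, closed under initial segments) together
with the assignment of a mover to every history.  The movers are the elements of `Option N`:
`some i` is the player `i : N` and `none` is the chance player. -/
structure GameTree (N A : Type*) where
  /-- the finite set `H` of histories -/
  hist : Finset (List A)
  nil_mem : [] ∈ hist
  prefix_mem : ∀ (h : List A) (a : A), h ++ [a] ∈ hist → h ∈ hist
  /-- `P(h)`; only its values at nonterminal histories matter -/
  player : List A → Option N

namespace GameTree

variable {N A : Type*} [DecidableEq N] [DecidableEq A] (T : GameTree N A)

/-- `A(h)`, the set of actions available after the history `h`. -/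
def actions (h : List A) : Finset A :=
  (T.hist.biUnion List.toFinset).filter (fun a => h ++ [a] ∈ T.hist)

/-- The set `Z` of terminal histories. -/
def terminal : Finset (List A) := T.hist.filter (fun h => T.actions h = ∅)

/-- The nonterminal histories after which `p` moves. -/
def decisionNodes (p : Option N) : Finset (List A) :=
  T.hist.filter (fun h => (T.actions h).Nonempty ∧ T.player h = p)

end GameTree

/-- A finite extensive-form game with player set `N` and chance. -/
structure ExtensiveGame (N A : Type*) [DecidableEq N] [DecidableEq A] extends GameTree N A where
  /-- `f_c(a | h)` -/
  chance : List A → A → ℝ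
  chance_nonneg : ∀ h ∈ toGameTree.decisionNodes none, ∀ a ∈ toGameTree.actions h, 0 ≤ chance h a
  chance_sum : ∀ h ∈ toGameTree.decisionNodes none, ∑ a ∈ toGameTree.actions h, chance h a = 1
  /-- the information partition of each player -/
  info : ∀ i : N, Finpartition (toGameTree.decisionNodes (some i))
  actions_eq : ∀ i : N, ∀ I ∈ (info i).parts, ∀ h ∈ I, ∀ h' ∈ I,
    toGameTree.actions h = toGameTree.actions h'
  /-- the payoffs `u_z^i(h)`; only the values at terminal histories matter -/
  payoff : N → List A → ℝ

/-- A finite set of moves.  A move is a pair (information set, action chosen there), so that equal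
labels at different information sets are kept apart. -/
abbrev MoveSet (A : Type*) := Finset (Finset (List A) × A)

/-- A real function on sequences, for every player. -/
abbrev PlanProfile (N A : Type*) := N → MoveSet A → ℝ

namespace ExtensiveGame

variable {N A : Type*} [DecidableEq N] [DecidableEq A] (G : ExtensiveGame N A)

/-- The information partition of a mover; chance observes everything. -/
def infoPartition : (p : Option N) → Finpartition (G.decisionNodes p)
  | some i => G.info i
  | none => ⊥

/-- The collection of information sets of a mover. -/
def infoSets (p : Option N) : Finset (Finset (List A)) := (G.infoPartition p).parts

/-- The information set that contains the nonterminal history `h`. -/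
def infoAt (h : List A) : Finset (List A) := (G.infoPartition (G.player h)).part h

/-- `A(I)`: the common action set of the histories in `I`. -/
def infoActions (I : Finset (List A)) : Finset A := I.biUnion G.actions

/-- The record of the mover `p` along the history `h`: the information sets of `p` that are passed
and the actions taken there, in chronological order. -/
def record (p : Option N) (h : List A) : List (Finset (List A) × A) :=
  (List.range h.length).filterMap fun k =>
    if G.player (h.take k) = p then (h[k]?).map fun a => (G.infoAt (h.take k), a) else none

/-- Perfect recall: histories in the same information set of a player give this player the same
record. -/
def PerfectRecall : Prop :=
  ∀ i : N, ∀ I ∈ G.infoSets (some i), ∀ h ∈ I, ∀ h' ∈ I,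
    G.record (some i) h = G.record (some i) h'

/-! ### Sequences -/

/-- `ϖ^p_h`: the sequence of `p` that is defined by the history `h`. -/
def seqOf (p : Option N) (h : List A) : MoveSet A := (G.record p h).toFinset

/-- `W^p`: the set of sequences of `p`; it contains the empty sequence `∅`. -/
def seqs (p : Option N) : Finset (MoveSet A) := G.hist.image (G.seqOf p)

/-- `ϖ^p_I`: the sequence of `p` leading to the information set `I`; by perfect recall all
histories in `I` define the same sequence. -/
def seqTo (p : Option N) (I : Finset (List A)) : MoveSet A := I.biUnion (G.seqOf p)

/-- `ϖ^p_I a`: the extension by `a` of the sequence leading to `I`. -/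
def seqExt (p : Option N) (I : Finset (List A)) (a : A) : MoveSet A :=
  insert (I, a) (G.seqTo p I)

/-! ### Realization plans and payoffs -/

/-- `Λ^i`: the realization plans of player `i`.  A function on `W^i` is represented by its
extension by zero. -/
def plans (i : N) : Set (MoveSet A → ℝ) :=
  {x | x ∅ = 1 ∧
    (∀ I ∈ G.infoSets (some i),
      ∑ a ∈ G.infoActions I, x (G.seqExt (some i) I a) = x (G.seqTo (some i) I)) ∧
    (∀ I ∈ G.infoSets (some i), ∀ a ∈ G.infoActions I, 0 ≤ x (G.seqExt (some i) I a)) ∧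
    ∀ w, w ∉ G.seqs (some i) → x w = 0}

/-- `Λ`: the realization plan profiles. -/
def planProfiles : Set (PlanProfile N A) := {γ | ∀ i, γ i ∈ G.plans i}

/-- A profile that is positive at every sequence of every player. -/
def IsPositive (γ : PlanProfile N A) : Prop := ∀ i, ∀ w ∈ G.seqs (some i), 0 < γ i w

/-- The fixed realization plan of chance: the product of the probabilities of the chance moves
in `w`. -/
def chancePlan (w : MoveSet A) : ℝ :=
  ∏ h ∈ G.decisionNodes none, ∏ a ∈ (G.actions h).filter (fun a => ({h}, a) ∈ w), G.chance h a

/-- The realization plan of a mover in the profile `γ`. -/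
def planOf (γ : PlanProfile N A) : Option N → MoveSet A → ℝ
  | some i => γ i
  | none => G.chancePlan

variable [Fintype N]

/-- `g^i(ϖ)` for a profile `ϖ` of sequences: the payoff at the terminal history that defines `ϖ`
(there is at most one), and `0` if there is none. -/
def seqPayoff (i : N) (w : Option N → MoveSet A) : ℝ :=
  ∑ h ∈ G.terminal.filter (fun h => ∀ p, w p = G.seqOf p h), G.payoff i h

/-- `g^i(ϖ^i, γ^{-i})`: the expected payoff of player `i` at the sequence `v`; the sum runs over
the profiles of sequences whose `i`-th entry is `v`. -/
def payoffAt (i : N) (v : MoveSet A) (γ : PlanProfile N A) : ℝ :=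
  ∑ w ∈ Fintype.piFinset (fun p : Option N => if p = some i then {v} else G.seqs p),
    G.seqPayoff i w * ∏ p ∈ Finset.univ.erase (some i), G.planOf γ p (w p)

/-- `g^i(x, γ^{-i})`: the expected payoff of player `i` from the plan `x` against `γ`. -/
def expectedPayoff (i : N) (x : MoveSet A → ℝ) (γ : PlanProfile N A) : ℝ :=
  ∑ w ∈ G.seqs (some i), x w * G.payoffAt i w γ

/-- `g^i_m(ϖ^i, γ^{-i})`: the maximal payoff of player `i` against `γ` over the realization plans
that play the sequence `v` with probability one. -/
def maxPayoff (i : N) (v : MoveSet A) (γ : PlanProfile N A) : ℝ :=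
  sSup ((fun x => G.expectedPayoff i x γ) '' {x | x ∈ G.plans i ∧ x v = 1})

/-! ### Proper equilibrium through ratio inequalities -/

/-- `ε`-sequence-form proper equilibrium, ratio form. -/
def IsEpsProperRatio (ε : ℝ) (γ : PlanProfile N A) : Prop :=
  γ ∈ G.planProfiles ∧ G.IsPositive γ ∧
    ∀ i, ∀ v ∈ G.seqs (some i), ∀ w ∈ G.seqs (some i),
      G.maxPayoff i v γ < G.maxPayoff i w γ → γ i v ≤ ε * γ i w

/-- Sequence-form proper equilibrium, ratio form. -/
def IsProperRatio (γ : PlanProfile N A) : Prop :=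
  γ ∈ G.planProfiles ∧ ∃ (ε : ℕ → ℝ) (η : ℕ → PlanProfile N A),
    (∀ k, 0 < ε k) ∧ Tendsto ε atTop (𝓝 0) ∧ (∀ k, G.IsEpsProperRatio (ε k) (η k)) ∧
      MapClusterPt γ atTop η

/-! ### Proper equilibrium through perturbed games -/

/-- `κ_i(ϖ)`: one plus the number of free realization variables at the information sets of player
`i` that are reached through the sequence `w`. -/
def kappa (i : N) (w : MoveSet A) : ℕ :=
  (∑ I ∈ (G.infoSets (some i)).filter (fun I => w ⊆ G.seqTo (some i) I),
    ((G.infoActions I).card - 1)) + 1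

/-- `r^i_l(δ)` for `1 ≤ l ≤ κ_i(∅)`, where `d` is the vector `δ^i`. -/
def perturb (i : N) (d : ℕ → ℝ) (l : ℕ) : ℝ := ∏ q ∈ Finset.Icc 1 (G.kappa i ∅ - l), d q

/-- The family `𝓔^i`: nonempty sets of nonempty sequences that do not contain all the extensions
at any information set, and in which no sequence is properly contained in another one. -/
def IsAdmissible (i : N) (E : Finset (MoveSet A)) : Prop :=
  E ⊆ G.seqs (some i) ∧ E.Nonempty ∧ ∅ ∉ E ∧
    (∀ I ∈ G.infoSets (some i), ¬ (G.infoActions I).image (G.seqExt (some i) I) ⊆ E) ∧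
    ∀ v ∈ E, ∀ w ∈ E, ¬ w ⊂ v

/-- `q^i(E)` -/
def weight (i : N) (E : Finset (MoveSet A)) : ℕ := ∑ w ∈ E, G.kappa i w

/-- `Λ^i(δ)`: the perturbed strategy space of player `i`. -/
def perturbedPlans (i : N) (d : ℕ → ℝ) : Set (MoveSet A → ℝ) :=
  {x | x ∈ G.plans i ∧ ∀ E, G.IsAdmissible i E →
    ∑ q ∈ Finset.Icc 1 (G.weight i E), G.perturb i d q ≤ ∑ w ∈ E, x w}

/-- The objective of player `i` in the perturbed game: the expected payoff without the constant
term of the empty sequence. -/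
def objective (i : N) (x : MoveSet A → ℝ) (γ : PlanProfile N A) : ℝ :=
  ∑ I ∈ G.infoSets (some i), ∑ a ∈ G.infoActions I,
    x (G.seqExt (some i) I a) * G.payoffAt i (G.seqExt (some i) I a) γ

/-- Nash equilibrium of the perturbed game `Γ_s(δ)`. -/
def IsPerturbedNash (δ : N → ℕ → ℝ) (γ : PlanProfile N A) : Prop :=
  ∀ i, γ i ∈ G.perturbedPlans i (δ i) ∧
    ∀ x ∈ G.perturbedPlans i (δ i), G.objective i x γ ≤ G.objective i (γ i) γ

/-- `ε`-sequence-form proper equilibrium, perturbed-game form. -/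
def IsEpsProperPerturbed (ε : ℝ) (γ : PlanProfile N A) : Prop :=
  γ ∈ G.planProfiles ∧ G.IsPositive γ ∧ ∃ δ : N → ℕ → ℝ,
    (∀ i, ∀ l ∈ Finset.Icc 1 (G.kappa i ∅), 0 < δ i l ∧ δ i l ≤ ε) ∧ G.IsPerturbedNash δ γ

/-- Sequence-form proper equilibrium, perturbed-game form. -/
def IsProperPerturbed (γ : PlanProfile N A) : Prop :=
  γ ∈ G.planProfiles ∧ ∃ (ε : ℕ → ℝ) (η : ℕ → PlanProfile N A),
    (∀ k, 0 < ε k) ∧ Tendsto ε atTop (𝓝 0) ∧ (∀ k, G.IsEpsProperPerturbed (ε k) (η k)) ∧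
      Tendsto η atTop (𝓝 γ)

end ExtensiveGame

end

/-!
Fix a player `i` and the plans of the others. Backward induction over the information sets writes
the payoff of `i` as a constant minus the expected value of nonnegative *losses* `ℓ` of the single
moves, where every information set offers a move without loss. Hence the maximal payoff at a
sequence `w` is a constant minus the total loss along `w`, and both notions of equilibrium only
depend on these totals.

For a level `t > 0` let the cut at `t` be the set of sequences whose total loss reaches `t` for the
first time. The layer-cake formula turns the expected loss of a plan into a positive combination of
the probabilities of its cuts. Each cut is admissible and has maximal weight among the admissible
sets of sequences of total loss at least `t`, so minimizing the expected loss over the perturbed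
plans makes every cut constraint bind. A plan that satisfies the ratio inequalities has rapidly
growing cut probabilities, which are then the partial sums of `r^i` for a suitable `δ^i`; this
makes it optimal. Conversely, binding cut constraints force the rapid growth.
-/

noncomputable section

section FiniteSums

variable {ι α : Type*}

lemma exists_forall_mem_eq_of_rank {β : Type*} [Nonempty β] (s : Finset ι) (rank : ι → ℕ)
    (Φ : (ι → β) → ι → β)
    (hΦ : ∀ u v, ∀ j ∈ s, (∀ k ∈ s, rank j < rank k → u k = v k) → Φ u j = Φ v j) :
    ∃ u, ∀ j ∈ s, u j = Φ u j := by
  inhabit β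
  have stable : ∀ n, ∀ j ∈ s, s.sup rank < rank j + n → Φ^[n] default j = Φ^[n + 1] default j := by
    intro n
    induction n with
    | zero => exact fun j hj hlt => absurd (Finset.le_sup (f := rank) hj) (not_le.2 hlt)
    | succ n ih =>
      intro j hj hlt
      rw [Function.iterate_succ_apply', Function.iterate_succ_apply' Φ (n + 1)]
      exact hΦ _ _ j hj fun k hk hjk => ih k hk (by omega)
  refine ⟨Φ^[s.sup rank + 1] default, fun j hj => ?_⟩
  rw [stable _ j hj (by omega), Function.iterate_succ_apply']

lemma exists_increments [LinearOrder α] {M : Type*} [AddCommGroup M] (T : Finset α) (F : α → M) :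
    ∃ c : α → M, ∀ s ∈ T, ∑ t ∈ T with t ≤ s, c t = F s ∧
      (c s = F s ∨ ∃ r ∈ T, r < s ∧ c s = F s - F r) := by
  induction T using Finset.induction_on_max with
  | empty => exact ⟨0, by simp⟩
  | insert a T ha ih =>
    obtain ⟨c, hc⟩ := ih
    have haT : a ∉ T := fun h => (ha a h).false
    set c' := Function.update c a (F a - ∑ t ∈ T, c t) with hc'
    have hc'a : c' a = F a - ∑ t ∈ T, c t := Function.update_self ..
    have hc'T : ∀ t ∈ T, c' t = c t := fun t ht => Function.update_of_ne (ha t ht).ne _ _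
    refine ⟨c', fun s hs => ?_⟩
    rcases Finset.mem_insert.1 hs with rfl | hs
    · have hfilter : (insert s T).filter (· ≤ s) = insert s T :=
        Finset.filter_true_of_mem fun t ht => (Finset.mem_insert.1 ht).elim le_of_eq
          fun ht => (ha t ht).le
      refine ⟨?_, ?_⟩
      · rw [hfilter, Finset.sum_insert haT, hc'a, Finset.sum_congr rfl hc'T, sub_add_cancel]
      · rcases T.eq_empty_or_nonempty with rfl | hT
        · exact Or.inl (by simpa using hc'a)
        · have hmax := T.max'_mem hT
          refine Or.inr ⟨_, Finset.mem_insert_of_mem hmax, ha _ hmax, ?_⟩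
          rw [hc'a, ← (hc _ hmax).1, Finset.filter_true_of_mem fun t ht => T.le_max' t ht]
    · have hfilter : (insert a T).filter (· ≤ s) = T.filter (· ≤ s) := by
        rw [Finset.filter_insert, if_neg (ha s hs).not_ge]
      refine ⟨?_, ?_⟩
      · rw [hfilter, ← (hc s hs).1]
        exact Finset.sum_congr rfl fun t ht => hc'T t (Finset.mem_filter.1 ht).1
      · rw [hc'T s hs]
        exact (hc s hs).2.imp_right fun ⟨r, hr, h⟩ => ⟨r, Finset.mem_insert_of_mem hr, h⟩

lemma exists_weights_of_cumulative (s : Finset ι) (n : ι → ℕ) {F : ℕ → ℝ} (hF : Monotone F)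
    (hF0 : 0 ≤ F 0) :
    ∃ τ : ι → ℝ, ∀ w ∈ s, ∑ v ∈ s with n v ≤ n w, τ v = F (n w) ∧
      F (n w) - F (n w - 1) ≤ s.card * τ w := by
  obtain ⟨c, hc⟩ := exists_increments (s.image n) F
  have hcF : ∀ w ∈ s, F (n w) - F (n w - 1) ≤ c (n w) := by
    intro w hw
    rcases (hc _ (Finset.mem_image_of_mem n hw)).2 with h | ⟨q, -, hq, h⟩
    · rw [h]
      exact sub_le_self _ (hF0.trans (hF (Nat.zero_le _)))
    · rw [h]
      exact sub_le_sub_left (hF (Nat.le_sub_one_of_lt hq)) _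
  have hlevel : ∀ w ∈ s, (0 : ℝ) < (s.filter fun v => n v = n w).card := fun w hw =>
    Nat.cast_pos.2 (Finset.card_pos.2 ⟨w, Finset.mem_filter.2 ⟨hw, rfl⟩⟩)
  refine ⟨fun w => c (n w) / (s.filter fun v => n v = n w).card, fun w hw => ⟨?_, ?_⟩⟩
  · rw [← (hc _ (Finset.mem_image_of_mem n hw)).1, Finset.filter_image]
    refine (Finset.sum_image' _ fun v hv => ?_).symm
    obtain ⟨hv, hvw⟩ := Finset.mem_filter.1 hv
    have hfiber : (s.filter fun u => n u ≤ n w).filter (fun u => n u = n v) =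
        s.filter fun u => n u = n v := by
      rw [Finset.filter_filter]
      exact Finset.filter_congr fun u _ => ⟨fun h => h.2, fun h => ⟨h ▸ hvw, h⟩⟩
    rw [hfiber, Finset.sum_congr rfl fun u hu => by rw [(Finset.mem_filter.1 hu).2],
      Finset.sum_const, nsmul_eq_mul, mul_div_cancel₀ _ (hlevel v hv).ne']
  · refine (hcF w hw).trans ?_
    have hc0 : 0 ≤ c (n w) := (sub_nonneg.2 (hF (Nat.sub_le _ _))).trans (hcF w hw)
    calc c (n w) = (s.filter fun v => n v = n w).card *
          (c (n w) / (s.filter fun v => n v = n w).card) :=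
          (mul_div_cancel₀ _ (hlevel w hw).ne').symm
      _ ≤ s.card * (c (n w) / (s.filter fun v => n v = n w).card) := by
          gcongr
          exact Finset.filter_subset _ _

lemma exists_monotone_interpolation {s : Finset ι} (hs : s.Nonempty) {n : ι → ℕ} {Y : ι → ℝ}
    {σ : ℝ} (hY : ∀ v ∈ s, ∀ w ∈ s, n v ≤ n w → Y v ≤ Y w) (hσ : ∀ w ∈ s, σ ≤ Y w) :
    ∃ a : ℕ → ℝ, Monotone a ∧ (∀ q, σ ≤ a q) ∧ (∀ w ∈ s, a (n w) = Y w) ∧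
      ∀ q b, σ ≤ b → (∀ v ∈ s, n v ≤ q → Y v ≤ b) → a q ≤ b := by
  set a : ℕ → ℝ := fun q => s.sup' hs fun w => if n w ≤ q then Y w else σ
  have a_le {q b} (hσb : σ ≤ b) (hYb : ∀ v ∈ s, n v ≤ q → Y v ≤ b) : a q ≤ b :=
    Finset.sup'_le _ _ fun v hv => by
      split_ifs with h
      exacts [hYb v hv h, hσb]
  have le_a {q w} (hw : w ∈ s) : (if n w ≤ q then Y w else σ) ≤ a q :=
    Finset.le_sup' (fun w => if n w ≤ q then Y w else σ) hw
  have Y_le_a {q w} (hw : w ∈ s) (h : n w ≤ q) : Y w ≤ a q := by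
    simpa only [if_pos h] using le_a (q := q) hw
  have σ_le_a q : σ ≤ a q := by
    obtain ⟨w, hw⟩ := hs
    refine le_trans ?_ (le_a hw)
    split_ifs
    exacts [hσ w hw, le_rfl]
  exact ⟨a, fun q r hqr => a_le (σ_le_a r) fun v hv h => Y_le_a hv (h.trans hqr), σ_le_a,
    fun w hw => le_antisymm (a_le (hσ w hw) fun v hv h => hY v hv w hw h) (Y_le_a hw le_rfl),
    fun _ _ => a_le⟩

lemma exists_geometric_growth {s : Finset ι} (hs : s.Nonempty) {n : ι → ℕ} {X μ : ι → ℝ} {κ : ℕ}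
    {θ : ℝ} (hθ : 0 < θ) (hθ1 : θ ≤ 1) (hnκ : ∀ w ∈ s, n w ≤ κ) (hμ : ∀ w ∈ s, 0 < μ w)
    (hμX : ∀ w ∈ s, μ w ≤ X w) (hlevel : ∀ v ∈ s, ∀ w ∈ s, n v = n w → X v = X w)
    (hsep : ∀ v ∈ s, ∀ w ∈ s, n v < n w → X v ≤ θ ^ κ * μ w) :
    ∃ S : ℕ → ℝ, (∀ q, 0 < S q) ∧ (∀ q, S q ≤ θ * S (q + 1)) ∧
      ∀ w ∈ s, S (n w) = X w ∧ ∀ q < n w, S q ≤ μ w := by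
  obtain ⟨w₀, hw₀, hmin⟩ := s.exists_min_image μ hs
  have hpow {q} (hq : q ≤ κ) : θ ^ κ ≤ θ ^ q := pow_le_pow_of_le_one hθ.le hθ1 hq
  have hσμ {w q} (hw : w ∈ s) (hq : q ≤ κ) : θ ^ κ * μ w₀ ≤ μ w * θ ^ q := by
    rw [mul_comm]
    exact mul_le_mul (hmin w hw) (hpow hq) (by positivity) (hμ w hw).le
  have hμXn {w} (hw : w ∈ s) : μ w * θ ^ n w ≤ X w * θ ^ n w :=
    mul_le_mul_of_nonneg_right (hμX w hw) (by positivity)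
  have hsep' {v w q} (hv : v ∈ s) (hw : w ∈ s) (hvw : n v < n w) (hq : q ≤ κ) :
      X v * θ ^ n v ≤ μ w * θ ^ q :=
    calc X v * θ ^ n v ≤ X v :=
          mul_le_of_le_one_right ((hμ v hv).le.trans (hμX v hv)) (pow_le_one₀ hθ.le hθ1)
      _ ≤ θ ^ κ * μ w := hsep v hv w hw hvw
      _ ≤ μ w * θ ^ q := by
          rw [mul_comm]
          exact mul_le_mul_of_nonneg_left (hpow hq) (hμ w hw).le
  -- Rescaling by `θ ^ q` turns the growth condition on `S` into monotonicity.
  obtain ⟨a, ha, hσa, haX, ha_le⟩ := exists_monotone_interpolation hs (n := n)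
    (Y := fun w => X w * θ ^ n w) (σ := θ ^ κ * μ w₀)
    (fun v hv w hw h => by
      rcases h.eq_or_lt with h | h
      · rw [hlevel v hv w hw h, h]
      · exact (hsep' hv hw h (hnκ w hw)).trans (hμXn hw))
    (fun w hw => (hσμ hw (hnκ w hw)).trans (hμXn hw))
  refine ⟨fun q => a q / θ ^ q, fun q => ?_, fun q => ?_, fun w hw => ⟨?_, fun q hq => ?_⟩⟩
  · exact div_pos ((mul_pos (pow_pos hθ κ) (hμ w₀ hw₀)).trans_le (hσa q)) (pow_pos hθ q)
  · calc a q / θ ^ q ≤ a (q + 1) / θ ^ q := by gcongr; exact ha q.le_succ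
      _ = θ * (a (q + 1) / θ ^ (q + 1)) := by field_simp; ring
  · exact (div_eq_iff (pow_pos hθ _).ne').2 (haX w hw)
  · have hqκ : q ≤ κ := hq.le.trans (hnκ w hw)
    exact (div_le_iff₀ (pow_pos hθ _)).2
      (ha_le q _ (hσμ hw hqκ) fun v hv hvq => hsep' hv hw (hvq.trans_lt hq) hqκ)

lemma exists_comparable_increments {S : ℕ → ℝ} {κ : ℕ} (hS : ∀ q, 0 < S q)
    (hS2 : ∀ q, S q ≤ S (q + 1) / 2) (hSκ : S κ = 1) :
    ∃ r : ℕ → ℝ, (∀ l, S l / 2 ≤ r l ∧ r l ≤ S l) ∧ r κ = 1 ∧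
      ∀ q, 0 < q → q < κ → ∑ l ∈ Finset.Icc 1 q, r l = S q := by
  refine ⟨fun l => if l = κ then 1 else if l ≤ 1 then S l else S l - S (l - 1), fun l => ?_,
    if_pos rfl, fun q hq => ?_⟩
  · beta_reduce
    have hl := hS l
    split_ifs with h1 h2
    · rw [h1, hSκ]
      norm_num
    · exact ⟨half_le_self hl.le, le_rfl⟩
    · have hpred := hS2 (l - 1)
      rw [Nat.sub_add_cancel (by omega)] at hpred
      exact ⟨by linarith, sub_le_self _ (hS _).le⟩
  · induction q, hq using Nat.le_induction with
    | base => exact fun h => by simp [h.ne]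
    | succ q hq ih =>
      intro h
      rw [Finset.sum_Icc_succ_top (by omega), ih (Nat.lt_of_succ_lt h), if_neg h.ne,
        if_neg (by omega), Nat.add_sub_cancel, add_sub_cancel]

end FiniteSums

/-! ### Histories and sequences -/

namespace GameTree

variable {N A : Type*} (T : GameTree N A)

lemma hist_prefix_closed {h h' : List A} (hp : h' <+: h) (hh : h ∈ T.hist) : h' ∈ T.hist := by
  induction h using List.reverseRecOn with
  | nil => rwa [List.prefix_nil.1 hp]
  | append_singleton l a ih =>
    rcases List.prefix_concat_iff.1 hp with rfl | hp
    · exact hh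
    · exact ih hp (T.prefix_mem _ _ hh)

variable {T} in
lemma mem_actions [DecidableEq A] {h : List A} {a : A} : a ∈ T.actions h ↔ h ++ [a] ∈ T.hist :=
  ⟨fun ha => (Finset.mem_filter.1 ha).2, fun ha =>
    Finset.mem_filter.2 ⟨Finset.mem_biUnion.2 ⟨_, ha, by simp⟩, ha⟩⟩

end GameTree

namespace ExtensiveGame

variable {N A : Type*} [DecidableEq N] [DecidableEq A] {G : ExtensiveGame N A}

section Histories

variable (p : Option N) {h h' : List A}

lemma record_concat (h : List A) (a : A) :
    G.record p (h ++ [a]) =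
      G.record p h ++ (if G.player h = p then [(G.infoAt h, a)] else []) := by
  unfold record
  rw [List.length_append, List.length_singleton, List.range_succ, List.filterMap_append]
  congr 1
  · refine List.filterMap_congr fun k hk => ?_
    have hk : k < h.length := List.mem_range.1 hk
    rw [List.take_append_of_le_length hk.le, List.getElem?_append_left hk]
  · by_cases hp : G.player h = p <;> simp [hp]

lemma record_mono (hp : h' <+: h) : G.record p h' <+: G.record p h := by
  induction h using List.reverseRecOn with
  | nil => rw [List.prefix_nil.1 hp]
  | append_singleton l a ih =>
    rcases List.prefix_concat_iff.1 hp with rfl | hp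
    · exact List.prefix_refl _
    · rw [record_concat]
      exact (ih hp).trans (List.prefix_append _ _)

lemma seqOf_nil : G.seqOf p [] = ∅ := rfl

lemma seqOf_concat (h : List A) (a : A) :
    G.seqOf p (h ++ [a]) =
      if G.player h = p then insert (G.infoAt h, a) (G.seqOf p h) else G.seqOf p h := by
  ext m
  split_ifs with hp <;> simp [seqOf, record_concat, hp, or_comm]

lemma seqOf_mono (hp : h' <+: h) : G.seqOf p h' ⊆ G.seqOf p h := fun _ hm =>
  List.mem_toFinset.2 ((record_mono p hp).subset (List.mem_toFinset.1 hm))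

variable {p} in
lemma exists_prefix_of_mem_seqOf {m : Finset (List A) × A} (hm : m ∈ G.seqOf p h) :
    ∃ h', h' ++ [m.2] <+: h ∧ G.player h' = p ∧ G.infoAt h' = m.1 := by
  induction h using List.reverseRecOn with
  | nil => simp [seqOf_nil] at hm
  | append_singleton l a ih =>
    have extend : m ∈ G.seqOf p l →
        ∃ h', h' ++ [m.2] <+: l ++ [a] ∧ G.player h' = p ∧ G.infoAt h' = m.1 := fun hm =>
      (ih hm).imp fun _ h => ⟨h.1.trans (List.prefix_append _ _), h.2⟩
    rw [seqOf_concat] at hm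
    split_ifs at hm with hp
    · rcases Finset.mem_insert.1 hm with rfl | hm
      · exact ⟨l, List.prefix_refl _, hp, rfl⟩
      · exact extend hm
    · exact extend hm

end Histories

section InfoSets

variable {i : N} {I J : Finset (List A)} {a b : A} {h : List A}

lemma infoSet_nonempty (hI : I ∈ G.infoSets (some i)) : I.Nonempty :=
  (G.info i).nonempty_of_mem_parts hI

lemma mem_decisionNodes_of_mem (hI : I ∈ G.infoSets (some i)) (hh : h ∈ I) :
    h ∈ G.decisionNodes (some i) :=
  (G.info i).le hI hh

lemma mem_hist_of_mem (hI : I ∈ G.infoSets (some i)) (hh : h ∈ I) : h ∈ G.hist :=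
  (Finset.mem_filter.1 (mem_decisionNodes_of_mem hI hh)).1

lemma player_eq (hI : I ∈ G.infoSets (some i)) (hh : h ∈ I) : G.player h = some i :=
  (Finset.mem_filter.1 (mem_decisionNodes_of_mem hI hh)).2.2

lemma mem_decisionNodes_of_concat (hh : h ++ [a] ∈ G.hist) (hp : G.player h = some i) :
    h ∈ G.decisionNodes (some i) :=
  Finset.mem_filter.2 ⟨G.prefix_mem _ _ hh, ⟨a, GameTree.mem_actions.2 hh⟩, hp⟩

lemma infoAt_eq_part (hp : G.player h = some i) : G.infoAt h = (G.info i).part h := by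
  unfold infoAt
  rw [hp]
  rfl

lemma infoAt_eq (hI : I ∈ G.infoSets (some i)) (hh : h ∈ I) : G.infoAt h = I := by
  rw [infoAt_eq_part (player_eq hI hh)]
  exact (G.info i).part_eq_of_mem hI hh

lemma infoAt_mem_infoSets (hh : h ∈ G.decisionNodes (some i)) :
    G.infoAt h ∈ G.infoSets (some i) := by
  rw [infoAt_eq_part (Finset.mem_filter.1 hh).2.2]
  exact (G.info i).part_mem.2 hh

lemma mem_infoAt (hh : h ∈ G.decisionNodes (some i)) : h ∈ G.infoAt h := by
  rw [infoAt_eq_part (Finset.mem_filter.1 hh).2.2]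
  exact (G.info i).mem_part hh

lemma infoActions_nonempty (hI : I ∈ G.infoSets (some i)) : (G.infoActions I).Nonempty := by
  obtain ⟨h, hh⟩ := infoSet_nonempty hI
  obtain ⟨a, ha⟩ := (Finset.mem_filter.1 (mem_decisionNodes_of_mem hI hh)).2.1
  exact ⟨a, Finset.mem_biUnion.2 ⟨h, hh, ha⟩⟩

end InfoSets

section Moves

variable (G) in
/-- The moves of player `i`: pairs of an information set and an action available there.  They
index the nonempty sequences through `seqExt`. -/
def moves (i : N) : Finset (Finset (List A) × A) :=
  (G.infoSets (some i)).biUnion fun I => (G.infoActions I).image (Prod.mk I)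

variable {i : N} {I : Finset (List A)} {a : A} {m : Finset (List A) × A} {h : List A}

lemma mem_moves : m ∈ G.moves i ↔ m.1 ∈ G.infoSets (some i) ∧ m.2 ∈ G.infoActions m.1 := by
  simp only [moves, Finset.mem_biUnion, Finset.mem_image]
  exact ⟨fun ⟨I, hI, a, ha, hm⟩ => hm ▸ ⟨hI, ha⟩, fun hm => ⟨m.1, hm.1, m.2, hm.2, rfl⟩⟩

lemma sum_moves {M : Type*} [AddCommMonoid M] (f : Finset (List A) × A → M) :
    ∑ m ∈ G.moves i, f m = ∑ I ∈ G.infoSets (some i), ∑ a ∈ G.infoActions I, f (I, a) := by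
  rw [moves, Finset.sum_biUnion]
  · exact Finset.sum_congr rfl fun I _ => Finset.sum_image (Prod.mk_right_injective I).injOn
  · refine fun I _ J _ hIJ => Finset.disjoint_left.2 fun m hI hJ => hIJ ?_
    obtain ⟨a, -, rfl⟩ := Finset.mem_image.1 hI
    obtain ⟨b, -, hb⟩ := Finset.mem_image.1 hJ
    exact (congrArg Prod.fst hb).symm

lemma exists_prefix_of_mem_seqOf_of_mem_hist (hh : h ∈ G.hist) (hm : m ∈ G.seqOf (some i) h) :
    m ∈ G.moves i ∧ ∃ h' ∈ m.1, h' ++ [m.2] <+: h := by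
  obtain ⟨h', hpre, hp, hm⟩ := exists_prefix_of_mem_seqOf hm
  have hh' := G.hist_prefix_closed hpre hh
  have hd := mem_decisionNodes_of_concat hh' hp
  have hmem : h' ∈ m.1 := hm ▸ mem_infoAt hd
  exact ⟨mem_moves.2 ⟨hm ▸ infoAt_mem_infoSets hd,
    Finset.mem_biUnion.2 ⟨h', hmem, GameTree.mem_actions.2 hh'⟩⟩, h', hmem, hpre⟩

lemma seqTo_eq (hG : G.PerfectRecall) (hI : I ∈ G.infoSets (some i)) (hh : h ∈ I) :
    G.seqTo (some i) I = G.seqOf (some i) h := by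
  refine Finset.Subset.antisymm (Finset.biUnion_subset.2 fun h' hh' => ?_)
    (Finset.subset_biUnion_of_mem (G.seqOf (some i)) hh)
  rw [seqOf, hG i I hI h' hh' h hh, ← seqOf]

lemma seqExt_eq (hG : G.PerfectRecall) (hI : I ∈ G.infoSets (some i)) (hh : h ∈ I) (a : A) :
    G.seqExt (some i) I a = G.seqOf (some i) (h ++ [a]) := by
  rw [seqOf_concat, if_pos (player_eq hI hh), seqExt, seqTo_eq hG hI hh, infoAt_eq hI hh]

lemma notMem_seqTo (hG : G.PerfectRecall) (hI : I ∈ G.infoSets (some i)) (a : A) :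
    (I, a) ∉ G.seqTo (some i) I := by
  obtain ⟨h, hh⟩ := infoSet_nonempty hI
  rw [seqTo_eq hG hI hh]
  intro hm
  obtain ⟨-, h', hh', hpre⟩ := exists_prefix_of_mem_seqOf_of_mem_hist (mem_hist_of_mem hI hh) hm
  have hlen := (record_mono (G := G) (some i) hpre).length_le
  rw [record_concat, if_pos (player_eq hI hh'), hG i I hI h' hh' h hh, List.length_append,
    List.length_singleton] at hlen
  omega

end Moves

section Sequences

variable {i : N} {I J : Finset (List A)} {a b : A} {m : Finset (List A) × A} {u v w : MoveSet A}

lemma mem_seqExt_self (p : Option N) (I : Finset (List A)) (a : A) : (I, a) ∈ G.seqExt p I a :=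
  Finset.mem_insert_self _ _

lemma seqExt_ne_empty (p : Option N) (I : Finset (List A)) (a : A) : G.seqExt p I a ≠ ∅ :=
  Finset.insert_ne_empty _ _

lemma seqTo_subset_seqExt (p : Option N) (I : Finset (List A)) (a : A) :
    G.seqTo p I ⊆ G.seqExt p I a :=
  Finset.subset_insert _ _

lemma seqTo_ssubset_seqExt (hG : G.PerfectRecall) (hI : I ∈ G.infoSets (some i)) (a : A) :
    G.seqTo (some i) I ⊂ G.seqExt (some i) I a :=
  Finset.ssubset_insert (notMem_seqTo hG hI a)

lemma card_seqExt (hG : G.PerfectRecall) (hI : I ∈ G.infoSets (some i)) (a : A) :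
    (G.seqExt (some i) I a).card = (G.seqTo (some i) I).card + 1 :=
  Finset.card_insert_of_notMem (notMem_seqTo hG hI a)

lemma empty_mem_seqs (p : Option N) : ∅ ∈ G.seqs p :=
  Finset.mem_image.2 ⟨[], G.nil_mem, seqOf_nil p⟩

lemma seqTo_mem_seqs (hG : G.PerfectRecall) (hI : I ∈ G.infoSets (some i)) :
    G.seqTo (some i) I ∈ G.seqs (some i) := by
  obtain ⟨h, hh⟩ := infoSet_nonempty hI
  rw [seqTo_eq hG hI hh]
  exact Finset.mem_image_of_mem _ (mem_hist_of_mem hI hh)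

lemma seqExt_mem_seqs (hG : G.PerfectRecall) (hI : I ∈ G.infoSets (some i))
    (ha : a ∈ G.infoActions I) : G.seqExt (some i) I a ∈ G.seqs (some i) := by
  obtain ⟨h, hh, ha⟩ := Finset.mem_biUnion.1 ha
  rw [seqExt_eq hG hI hh]
  exact Finset.mem_image_of_mem _ (GameTree.mem_actions.1 ha)

lemma mem_moves_of_mem (hw : w ∈ G.seqs (some i)) (hm : m ∈ w) : m ∈ G.moves i := by
  obtain ⟨h, hh, rfl⟩ := Finset.mem_image.1 hw
  exact (exists_prefix_of_mem_seqOf_of_mem_hist hh hm).1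

lemma seqExt_subset_of_mem (hG : G.PerfectRecall) (hw : w ∈ G.seqs (some i)) (hm : m ∈ w) :
    G.seqExt (some i) m.1 m.2 ⊆ w := by
  have hI := (mem_moves.1 (mem_moves_of_mem hw hm)).1
  obtain ⟨h, hh, rfl⟩ := Finset.mem_image.1 hw
  obtain ⟨-, h', hh', hpre⟩ := exists_prefix_of_mem_seqOf_of_mem_hist hh hm
  rw [seqExt_eq hG hI hh']
  exact seqOf_mono _ hpre

lemma exists_seqExt (hG : G.PerfectRecall) (hw : w ∈ G.seqs (some i)) (hne : w ≠ ∅) :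
    ∃ I ∈ G.infoSets (some i), ∃ a ∈ G.infoActions I, w = G.seqExt (some i) I a := by
  obtain ⟨h, hh, rfl⟩ := Finset.mem_image.1 hw
  clear hw
  induction h using List.reverseRecOn with
  | nil => exact absurd (seqOf_nil _) hne
  | append_singleton l a ih =>
    by_cases hp : G.player l = some i
    · have hl := mem_decisionNodes_of_concat hh hp
      exact ⟨_, infoAt_mem_infoSets hl, a,
        Finset.mem_biUnion.2 ⟨l, mem_infoAt hl, GameTree.mem_actions.2 hh⟩,
        (seqExt_eq hG (infoAt_mem_infoSets hl) (mem_infoAt hl) a).symm⟩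
    · rw [seqOf_concat, if_neg hp] at hne ⊢
      exact ih (G.prefix_mem _ _ hh) hne

lemma seqs_induction (hG : G.PerfectRecall) {P : MoveSet A → Prop} (empty : P ∅)
    (seqExt : ∀ I ∈ G.infoSets (some i), ∀ a ∈ G.infoActions I, P (G.seqTo (some i) I) →
      P (G.seqExt (some i) I a)) (hw : w ∈ G.seqs (some i)) : P w := by
  induction hn : w.card using Nat.strong_induction_on generalizing w with
  | _ n ih =>
    rcases eq_or_ne w ∅ with rfl | hne
    · exact empty
    · obtain ⟨I, hI, a, ha, rfl⟩ := exists_seqExt hG hw hne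
      exact seqExt I hI a ha
        (ih _ (by rw [← hn, card_seqExt hG hI]; omega) (seqTo_mem_seqs hG hI) rfl)

lemma subset_seqTo_of_ssubset (hG : G.PerfectRecall) (hv : v ∈ G.seqs (some i))
    (hlt : v ⊂ G.seqExt (some i) I a) : v ⊆ G.seqTo (some i) I := fun m hm => by
  rcases Finset.mem_insert.1 (hlt.1 hm) with rfl | h
  · exact absurd (seqExt_subset_of_mem hG hv hm) hlt.2
  · exact h

lemma exists_prefix_of_subset_seqOf (hG : G.PerfectRecall) (hu : u ∈ G.seqs (some i))
    {h : List A} (hh : h ∈ G.hist) (huh : u ⊆ G.seqOf (some i) h) :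
    ∃ h', h' <+: h ∧ u = G.seqOf (some i) h' := by
  rcases eq_or_ne u ∅ with rfl | hne
  · exact ⟨[], List.nil_prefix, (seqOf_nil _).symm⟩
  · obtain ⟨I, hI, a, -, rfl⟩ := exists_seqExt hG hu hne
    obtain ⟨-, h', hh', hpre⟩ :=
      exists_prefix_of_mem_seqOf_of_mem_hist hh (huh (mem_seqExt_self _ I a))
    exact ⟨_, hpre, seqExt_eq hG hI hh' a⟩

lemma subset_total (hG : G.PerfectRecall) (hu : u ∈ G.seqs (some i)) (hv : v ∈ G.seqs (some i))
    (hw : w ∈ G.seqs (some i)) (huw : u ⊆ w) (hvw : v ⊆ w) : u ⊆ v ∨ v ⊆ u := by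
  obtain ⟨h, hh, rfl⟩ := Finset.mem_image.1 hw
  obtain ⟨h₁, hpre₁, rfl⟩ := exists_prefix_of_subset_seqOf hG hu hh huw
  obtain ⟨h₂, hpre₂, rfl⟩ := exists_prefix_of_subset_seqOf hG hv hh hvw
  exact (List.prefix_or_prefix_of_prefix hpre₁ hpre₂).imp (seqOf_mono _) (seqOf_mono _)

lemma action_unique (hG : G.PerfectRecall) (hw : w ∈ G.seqs (some i)) (ha : (I, a) ∈ w)
    (hb : (I, b) ∈ w) : a = b := by
  obtain ⟨hI, haI⟩ := mem_moves.1 (mem_moves_of_mem hw ha)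
  have hbI := (mem_moves.1 (mem_moves_of_mem hw hb)).2
  rcases subset_total hG (seqExt_mem_seqs hG hI haI) (seqExt_mem_seqs hG hI hbI) hw
    (seqExt_subset_of_mem hG hw ha) (seqExt_subset_of_mem hG hw hb) with h | h
  · exact congrArg Prod.snd <|
      (Finset.mem_insert.1 (h (mem_seqExt_self _ I a))).resolve_right (notMem_seqTo hG hI a)
  · exact congrArg Prod.snd <| Eq.symm <|
      (Finset.mem_insert.1 (h (mem_seqExt_self _ I b))).resolve_right (notMem_seqTo hG hI b)

lemma seqExt_inj (hG : G.PerfectRecall) (hJ : J ∈ G.infoSets (some i))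
    (h : G.seqExt (some i) I a = G.seqExt (some i) J b) : I = J ∧ a = b := by
  have hm : (I, a) ∈ G.seqExt (some i) J b := h ▸ mem_seqExt_self _ I a
  refine Prod.ext_iff.1 ((Finset.mem_insert.1 hm).resolve_right fun hm => ?_)
  have hsub := seqExt_subset_of_mem hG (seqTo_mem_seqs hG hJ) hm
  rw [h] at hsub
  exact (seqTo_ssubset_seqExt hG hJ b).not_subset hsub

lemma sum_of_subset_seqs (hG : G.PerfectRecall) {M : Type*} [AddCommMonoid M]
    {E : Finset (MoveSet A)} (hE : E ⊆ G.seqs (some i)) (hE0 : ∅ ∉ E) (f : MoveSet A → M) :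
    ∑ w ∈ E, f w =
      ∑ m ∈ G.moves i with G.seqExt (some i) m.1 m.2 ∈ E, f (G.seqExt (some i) m.1 m.2) := by
  symm
  refine Finset.sum_nbij (fun m => G.seqExt (some i) m.1 m.2)
    (fun m hm => (Finset.mem_filter.1 hm).2) ?_ ?_ fun _ _ => rfl
  · intro m _ m' hm' h
    exact Prod.ext_iff.2
      (seqExt_inj hG (mem_moves.1 (Finset.mem_filter.1 (Finset.mem_coe.1 hm')).1).1 h)
  · intro w hw
    obtain ⟨I, hI, a, ha, rfl⟩ := exists_seqExt hG (hE hw) (ne_of_mem_of_not_mem hw hE0)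
    exact ⟨(I, a), Finset.mem_coe.2 (Finset.mem_filter.2 ⟨mem_moves.2 ⟨hI, ha⟩, hw⟩), rfl⟩

lemma sum_seqs (hG : G.PerfectRecall) {M : Type*} [AddCommMonoid M] (f : MoveSet A → M) :
    ∑ w ∈ G.seqs (some i), f w = f ∅ + ∑ m ∈ G.moves i, f (G.seqExt (some i) m.1 m.2) := by
  rw [← Finset.add_sum_erase _ f (empty_mem_seqs _),
    sum_of_subset_seqs hG (Finset.erase_subset _ _) (Finset.notMem_erase _ _),
    Finset.filter_true_of_mem fun m hm => Finset.mem_erase.2 ⟨seqExt_ne_empty _ _ _,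
      seqExt_mem_seqs hG (mem_moves.1 hm).1 (mem_moves.1 hm).2⟩]

end Sequences

section Plans

variable {i : N} {I : Finset (List A)} {a : A} {v w : MoveSet A} {x : MoveSet A → ℝ}

lemma plan_nonneg (hG : G.PerfectRecall) (hx : x ∈ G.plans i) (w : MoveSet A) : 0 ≤ x w := by
  obtain ⟨hx0, -, hxnn, hxsupp⟩ := hx
  by_cases hw : w ∈ G.seqs (some i)
  · rcases eq_or_ne w ∅ with rfl | hne
    · exact hx0 ▸ zero_le_one
    · obtain ⟨I, hI, a, ha, rfl⟩ := exists_seqExt hG hw hne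
      exact hxnn I hI a ha
  · exact (hxsupp w hw).ge

lemma plan_seqExt_le (hG : G.PerfectRecall) (hx : x ∈ G.plans i) (hI : I ∈ G.infoSets (some i))
    (ha : a ∈ G.infoActions I) : x (G.seqExt (some i) I a) ≤ x (G.seqTo (some i) I) := by
  rw [← hx.2.1 I hI]
  exact Finset.single_le_sum (f := fun a => x (G.seqExt (some i) I a))
    (fun b _ => plan_nonneg hG hx _) ha

lemma plan_antitone (hG : G.PerfectRecall) (hx : x ∈ G.plans i) (hv : v ∈ G.seqs (some i))
    (hw : w ∈ G.seqs (some i)) (hvw : v ⊆ w) : x w ≤ x v := by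
  revert hvw
  refine seqs_induction hG (P := fun w => v ⊆ w → x w ≤ x v) ?_ (fun I hI a ha ih h => ?_) hw
  · exact fun h => (Finset.subset_empty.1 h).symm ▸ le_rfl
  · rcases h.eq_or_ssubset with rfl | h
    · exact le_rfl
    · exact (plan_seqExt_le hG hx hI ha).trans (ih (subset_seqTo_of_ssubset hG hv h))

lemma sum_mul_mem_plans {ι : Type*} {s : Finset ι} {τ : ι → ℝ} {y : ι → MoveSet A → ℝ}
    (hτ : ∀ k ∈ s, 0 ≤ τ k) (hτ1 : ∑ k ∈ s, τ k = 1) (hy : ∀ k ∈ s, y k ∈ G.plans i) :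
    (fun w => ∑ k ∈ s, τ k * y k w) ∈ G.plans i := by
  refine ⟨?_, fun I hI => ?_, fun I hI a ha => ?_, fun w hw => ?_⟩
  · rw [← hτ1]
    exact Finset.sum_congr rfl fun k hk => by rw [(hy k hk).1, mul_one]
  · rw [Finset.sum_comm]
    exact Finset.sum_congr rfl fun k hk => by rw [← Finset.mul_sum, (hy k hk).2.1 I hI]
  · exact Finset.sum_nonneg fun k hk => mul_nonneg (hτ k hk) ((hy k hk).2.2.1 I hI a ha)
  · exact Finset.sum_eq_zero fun k hk => by rw [(hy k hk).2.2.2 w hw, mul_zero]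

end Plans

/-! ### Losses -/

variable {i : N}

section Losses

variable {I : Finset (List A)} {v w : MoveSet A} {x : MoveSet A → ℝ}
  {ℓ : Finset (List A) × A → ℝ}

variable (G) in
/-- A loss assignment for player `i`: every move has a nonnegative loss, and every information set
offers an action without loss.  The losses of interest measure by how much a move falls short of
the value that backward induction assigns to its information set. -/
def IsLoss (i : N) (ℓ : Finset (List A) × A → ℝ) : Prop :=
  ∀ I ∈ G.infoSets (some i),
    (∀ a ∈ G.infoActions I, 0 ≤ ℓ (I, a)) ∧ ∃ a ∈ G.infoActions I, ℓ (I, a) = 0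

variable (G) in
/-- The expected loss of a realization plan. -/
def cost (i : N) (ℓ : Finset (List A) × A → ℝ) (x : MoveSet A → ℝ) : ℝ :=
  ∑ m ∈ G.moves i, x (G.seqExt (some i) m.1 m.2) * ℓ m

omit [DecidableEq A] in
/-- The total loss along a sequence. -/
def lossOf (ℓ : Finset (List A) × A → ℝ) (w : MoveSet A) : ℝ := ∑ m ∈ w, ℓ m

lemma exists_backwardInduction_value (hG : G.PerfectRecall) (c : MoveSet A → ℝ) :
    ∃ u : Finset (List A) → ℝ, ∀ I ∈ G.infoSets (some i), IsGreatest
      ((fun a => c (G.seqExt (some i) I a) +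
        ∑ J ∈ G.infoSets (some i) with G.seqTo (some i) J = G.seqExt (some i) I a, u J) ''
          G.infoActions I) (u I) := by
  obtain ⟨u, hu⟩ := exists_forall_mem_eq_of_rank (G.infoSets (some i))
    (fun I => (G.seqTo (some i) I).card) (fun u I => sSup ((fun a => c (G.seqExt (some i) I a) +
      ∑ J ∈ G.infoSets (some i) with G.seqTo (some i) J = G.seqExt (some i) I a, u J) ''
        G.infoActions I)) fun u v I hI huv => by
    congr 1
    refine Set.image_congr fun a _ => congrArg _ (Finset.sum_congr rfl fun J hJ => ?_)
    obtain ⟨hJ, hJI⟩ := Finset.mem_filter.1 hJ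
    exact huv J hJ (by rw [hJI, card_seqExt hG hI]; omega)
  refine ⟨u, fun I hI => ?_⟩
  rw [hu I hI]
  exact ((G.infoActions I).finite_toSet.image _).isCompact.isGreatest_sSup
    ((Finset.coe_nonempty.2 (infoActions_nonempty hI)).image _)

lemma sum_plan_mul_fiberwise (hG : G.PerfectRecall) (hx : x ∈ G.plans i)
    (u : Finset (List A) → ℝ) :
    ∑ w ∈ G.seqs (some i), x w * ∑ J ∈ G.infoSets (some i) with G.seqTo (some i) J = w, u J =
      ∑ m ∈ G.moves i, x (G.seqExt (some i) m.1 m.2) * u m.1 := by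
  calc _ = ∑ J ∈ G.infoSets (some i), x (G.seqTo (some i) J) * u J := by
        rw [← Finset.sum_fiberwise_of_maps_to fun J hJ => seqTo_mem_seqs hG hJ]
        refine Finset.sum_congr rfl fun w _ => ?_
        rw [Finset.mul_sum]
        exact Finset.sum_congr rfl fun J hJ => by rw [(Finset.mem_filter.1 hJ).2]
    _ = _ := by
        rw [sum_moves]
        exact Finset.sum_congr rfl fun J hJ => by rw [← hx.2.1 J hJ, Finset.sum_mul]

lemma exists_isLoss_sum_eq_sub_cost (hG : G.PerfectRecall) (c : MoveSet A → ℝ) :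
    ∃ ℓ, G.IsLoss i ℓ ∧ ∃ K : ℝ, ∀ x ∈ G.plans i,
      ∑ m ∈ G.moves i, x (G.seqExt (some i) m.1 m.2) * c (G.seqExt (some i) m.1 m.2) =
        K - G.cost i ℓ x := by
  obtain ⟨u, hu⟩ := exists_backwardInduction_value (i := i) hG c
  set r : MoveSet A → ℝ := fun w => ∑ J ∈ G.infoSets (some i) with G.seqTo (some i) J = w, u J
  refine ⟨fun m => u m.1 - (c (G.seqExt (some i) m.1 m.2) + r (G.seqExt (some i) m.1 m.2)),
    fun I hI => ⟨fun a ha => sub_nonneg.2 ((hu I hI).2 ⟨a, ha, rfl⟩), ?_⟩, r ∅, fun x hx => ?_⟩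
  · obtain ⟨a, ha, h⟩ := (hu I hI).1
    exact ⟨a, ha, sub_eq_zero.2 h.symm⟩
  · have htotal := sum_plan_mul_fiberwise hG hx u
    rw [sum_seqs hG, hx.1, one_mul] at htotal
    simp only [cost, mul_sub, mul_add, Finset.sum_sub_distrib, Finset.sum_add_distrib]
    linarith

lemma IsLoss.nonneg (hℓ : G.IsLoss i ℓ) {m : Finset (List A) × A} (hm : m ∈ G.moves i) :
    0 ≤ ℓ m :=
  (hℓ _ (mem_moves.1 hm).1).1 _ (mem_moves.1 hm).2

omit [DecidableEq A] in
lemma lossOf_empty : lossOf ℓ ∅ = 0 := Finset.sum_empty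

lemma lossOf_seqExt (hG : G.PerfectRecall) (hI : I ∈ G.infoSets (some i)) (a : A) :
    lossOf ℓ (G.seqExt (some i) I a) = lossOf ℓ (G.seqTo (some i) I) + ℓ (I, a) := by
  rw [lossOf, seqExt, Finset.sum_insert (notMem_seqTo hG hI a), add_comm, lossOf]

lemma lossOf_mono (hℓ : G.IsLoss i ℓ) (hw : w ∈ G.seqs (some i)) (hvw : v ⊆ w) :
    lossOf ℓ v ≤ lossOf ℓ w :=
  Finset.sum_le_sum_of_subset_of_nonneg hvw fun _ hm _ => hℓ.nonneg (mem_moves_of_mem hw hm)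

lemma lossOf_nonneg (hℓ : G.IsLoss i ℓ) (hw : w ∈ G.seqs (some i)) : 0 ≤ lossOf ℓ w :=
  Finset.sum_nonneg fun _ hm => hℓ.nonneg (mem_moves_of_mem hw hm)

lemma lossOf_le_cost (hG : G.PerfectRecall) (hℓ : G.IsLoss i ℓ) (hx : x ∈ G.plans i)
    (hw : w ∈ G.seqs (some i)) (hxw : x w = 1) : lossOf ℓ w ≤ G.cost i ℓ x := by
  have hmoves : w ⊆ G.moves i := fun m hm => mem_moves_of_mem hw hm
  calc lossOf ℓ w ≤ ∑ m ∈ w, x (G.seqExt (some i) m.1 m.2) * ℓ m := by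
        refine Finset.sum_le_sum fun m hm => ?_
        obtain ⟨hI, ha⟩ := mem_moves.1 (hmoves hm)
        have hle := plan_antitone hG hx (seqExt_mem_seqs hG hI ha) hw
          (seqExt_subset_of_mem hG hw hm)
        exact le_mul_of_one_le_left (hℓ.nonneg (hmoves hm)) (hxw ▸ hle)
    _ ≤ G.cost i ℓ x := Finset.sum_le_sum_of_subset_of_nonneg hmoves fun m hm _ =>
        mul_nonneg (plan_nonneg hG hx _) (hℓ.nonneg hm)

end Losses

section PurePlans

variable {I : Finset (List A)} {a : A} {w : MoveSet A} {S : Set (Finset (List A) × A)}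
  {ℓ : Finset (List A) × A → ℝ}

open Classical in
variable (G) in
/-- The realization plan that makes exactly the moves in `S`.  Pure strategies are encoded as sets
of moves, so that no action has to be named away from the information sets. -/
def purePlan (i : N) (S : Set (Finset (List A) × A)) (w : MoveSet A) : ℝ :=
  if w ∈ G.seqs (some i) ∧ ↑w ⊆ S then 1 else 0

open Classical in
lemma purePlan_seqExt (hG : G.PerfectRecall) (hI : I ∈ G.infoSets (some i))
    (ha : a ∈ G.infoActions I) : G.purePlan i S (G.seqExt (some i) I a) =
      if (I, a) ∈ S then G.purePlan i S (G.seqTo (some i) I) else 0 := by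
  have hsub : (↑(G.seqExt (some i) I a) : Set (Finset (List A) × A)) ⊆ S ↔
      (I, a) ∈ S ∧ ↑(G.seqTo (some i) I) ⊆ S := by
    rw [seqExt, Finset.coe_insert, Set.insert_subset_iff]
  simp only [purePlan, seqExt_mem_seqs hG hI ha, seqTo_mem_seqs hG hI, true_and, hsub, ite_and]

lemma purePlan_mem_plans (hG : G.PerfectRecall)
    (hS : ∀ I ∈ G.infoSets (some i), ∃! a, a ∈ G.infoActions I ∧ (I, a) ∈ S) :
    G.purePlan i S ∈ G.plans i := by
  classical
  refine ⟨if_pos ⟨empty_mem_seqs _, by simp⟩, fun I hI => ?_, fun I _ a _ => ?_,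
    fun w hw => if_neg fun h => hw h.1⟩
  · obtain ⟨a, ⟨ha, haS⟩, hunique⟩ := hS I hI
    rw [Finset.sum_eq_single_of_mem a ha fun b hb hba => ?_]
    · rw [purePlan_seqExt hG hI ha, if_pos haS]
    · rw [purePlan_seqExt hG hI hb, if_neg fun hbS => hba (hunique b ⟨hb, hbS⟩)]
  · unfold purePlan
    split_ifs <;> norm_num

lemma exists_pureStrategy_through (hG : G.PerfectRecall) (hℓ : G.IsLoss i ℓ)
    (hw : w ∈ G.seqs (some i)) :
    ∃ S : Set (Finset (List A) × A),
      (∀ I ∈ G.infoSets (some i), ∃! a, a ∈ G.infoActions I ∧ (I, a) ∈ S) ∧ ↑w ⊆ S ∧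
        ∀ m ∈ S, m ∉ w → ℓ m = 0 := by
  choose f hf hf0 using fun I hI => (hℓ I hI).2
  refine ⟨{m | m ∈ w ∨ (∀ b, (m.1, b) ∉ w) ∧ ∃ hI, m.2 = f m.1 hI}, fun I hI => ?_,
    fun m hm => Or.inl hm, ?_⟩
  · by_cases h : ∃ a, (I, a) ∈ w
    · obtain ⟨a, ha⟩ := h
      exact ⟨a, ⟨(mem_moves.1 (mem_moves_of_mem hw ha)).2, Or.inl ha⟩, fun b hb =>
        hb.2.elim (fun hb => action_unique hG hw hb ha) fun hb => absurd ha (hb.1 a)⟩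
    · push Not at h
      exact ⟨f I hI, ⟨hf I hI, Or.inr ⟨h, hI, rfl⟩⟩, fun b hb =>
        hb.2.elim (fun hb => absurd hb (h b)) fun ⟨_, _, hb⟩ => hb⟩
  · rintro m (hm | ⟨-, hI, hm⟩) hmw
    · exact absurd hm hmw
    · rw [← Prod.mk.eta (p := m), hm, hf0]

lemma exists_plan_cost_eq (hG : G.PerfectRecall) (hℓ : G.IsLoss i ℓ) (hw : w ∈ G.seqs (some i)) :
    ∃ x ∈ G.plans i, x w = 1 ∧ G.cost i ℓ x = lossOf ℓ w := by
  classical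
  obtain ⟨S, hS, hwS, hS0⟩ := exists_pureStrategy_through hG hℓ hw
  refine ⟨G.purePlan i S, purePlan_mem_plans hG hS, if_pos ⟨hw, hwS⟩, ?_⟩
  refine (Finset.sum_subset_zero_on_sdiff (fun m hm => mem_moves_of_mem hw hm)
    (fun m hm => ?_) fun m hm => ?_).symm
  · obtain ⟨hm, hmw⟩ := Finset.mem_sdiff.1 hm
    rw [purePlan_seqExt hG (mem_moves.1 hm).1 (mem_moves.1 hm).2]
    split_ifs with hmS
    · rw [hS0 m hmS hmw, mul_zero]
    · rw [zero_mul]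
  · have hsub := seqExt_subset_of_mem hG hw hm
    obtain ⟨hI, ha⟩ := mem_moves.1 (mem_moves_of_mem hw hm)
    rw [purePlan, if_pos ⟨seqExt_mem_seqs hG hI ha, (Finset.coe_subset.2 hsub).trans hwS⟩, one_mul]

end PurePlans

lemma exists_isLoss_payoff [Fintype N] (hG : G.PerfectRecall) (i : N) (γ : PlanProfile N A) :
    ∃ ℓ, G.IsLoss i ℓ ∧ ∃ K K' : ℝ,
      (∀ x ∈ G.plans i, G.objective i x γ = K - G.cost i ℓ x) ∧
      ∀ w ∈ G.seqs (some i), G.maxPayoff i w γ = K' - lossOf ℓ w := by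
  obtain ⟨ℓ, hℓ, K, hK⟩ := exists_isLoss_sum_eq_sub_cost (i := i) hG fun w => G.payoffAt i w γ
  have hobj : ∀ x ∈ G.plans i, G.objective i x γ = K - G.cost i ℓ x := fun x hx => by
    rw [← hK x hx, sum_moves, objective]
  have hexp : ∀ x ∈ G.plans i,
      G.expectedPayoff i x γ = G.payoffAt i ∅ γ + K - G.cost i ℓ x := fun x hx => by
    rw [expectedPayoff, sum_seqs hG, hx.1, one_mul, hK x hx, add_sub_assoc]
  refine ⟨ℓ, hℓ, K, G.payoffAt i ∅ γ + K, hobj, fun w hw => IsGreatest.csSup_eq ⟨?_, ?_⟩⟩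
  · obtain ⟨x, hx, hxw, hcost⟩ := exists_plan_cost_eq hG hℓ hw
    exact ⟨x, ⟨hx, hxw⟩, by rw [← hcost, ← hexp x hx]⟩
  · rintro _ ⟨x, ⟨hx, hxw⟩, rfl⟩
    exact (hexp x hx).trans_le (sub_le_sub_left (lossOf_le_cost hG hℓ hx hw hxw) _)

/-! ### Weights and cuts -/

section Weights

variable {I : Finset (List A)} {w : MoveSet A} {E F : Finset (MoveSet A)}

lemma kappa_pos (w : MoveSet A) : 0 < G.kappa i w := Nat.succ_pos _

lemma weight_eq_sum_infoSets (hG : G.PerfectRecall) (hE : E ⊆ G.seqs (some i)) (hE0 : ∅ ∉ E) :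
    G.weight i E = ∑ I ∈ G.infoSets (some i),
      ((E.filter fun w => w ⊆ G.seqTo (some i) I).card * ((G.infoActions I).card - 1) +
        ((G.infoActions I).filter fun a => G.seqExt (some i) I a ∈ E).card) := by
  simp only [weight, kappa, Finset.sum_add_distrib]
  congr 1
  · simp only [← smul_eq_mul, ← Finset.sum_const]
    refine Finset.sum_comm' fun w I => ?_
    simp only [Finset.mem_filter]
    tauto
  · rw [sum_of_subset_seqs hG hE hE0, Finset.sum_filter, sum_moves]
    simp only [Finset.card_filter]

lemma IsAdmissible.mono (hE : G.IsAdmissible i E) (hFE : F ⊆ E) (hF : F.Nonempty) :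
    G.IsAdmissible i F :=
  ⟨hFE.trans hE.1, hF, fun h => hE.2.2.1 (hFE h), fun I hI h => hE.2.2.2.1 I hI (h.trans hFE),
    fun v hv w hw => hE.2.2.2.2 v (hFE hv) w (hFE hw)⟩

lemma IsAdmissible.card_filter_seqExt_le (hE : G.IsAdmissible i E)
    (hI : I ∈ G.infoSets (some i)) :
    ((G.infoActions I).filter fun a => G.seqExt (some i) I a ∈ E).card ≤
      (G.infoActions I).card - 1 := by
  refine Nat.le_sub_one_of_lt (Finset.card_lt_card ?_)
  refine (Finset.filter_subset _ _).ssubset_of_ne fun h => hE.2.2.2.1 I hI ?_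
  exact Finset.image_subset_iff.2 fun a ha => Finset.filter_eq_self.1 h a ha

lemma IsAdmissible.card_mul_add_card_le (hG : G.PerfectRecall) (hE : G.IsAdmissible i E)
    (hI : I ∈ G.infoSets (some i)) :
    (E.filter fun w => w ⊆ G.seqTo (some i) I).card * ((G.infoActions I).card - 1) +
      ((G.infoActions I).filter fun a => G.seqExt (some i) I a ∈ E).card ≤
        (G.infoActions I).card - 1 := by
  by_cases h : ∃ w ∈ E, w ⊆ G.seqTo (some i) I
  · obtain ⟨w, hw, hwI⟩ := h
    have hbelow : (E.filter fun w => w ⊆ G.seqTo (some i) I).card ≤ 1 := by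
      refine Finset.card_le_one.2 fun u hu v hv => ?_
      obtain ⟨hu, huI⟩ := Finset.mem_filter.1 hu
      obtain ⟨hv, hvI⟩ := Finset.mem_filter.1 hv
      rcases subset_total hG (hE.1 hu) (hE.1 hv) (seqTo_mem_seqs hG hI) huI hvI with h | h
      · exact h.eq_of_not_ssubset (hE.2.2.2.2 v hv u hu)
      · exact (h.eq_of_not_ssubset (hE.2.2.2.2 u hu v hv)).symm
    have hat : (G.infoActions I).filter (fun a => G.seqExt (some i) I a ∈ E) = ∅ :=
      Finset.filter_eq_empty_iff.2 fun a _ ha =>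
        hE.2.2.2.2 _ ha w hw (hwI.trans_ssubset (seqTo_ssubset_seqExt hG hI a))
    rw [hat, Finset.card_empty, add_zero]
    exact (Nat.mul_le_mul_right _ hbelow).trans_eq (one_mul _)
  · have hbelow : E.filter (fun w => w ⊆ G.seqTo (some i) I) = ∅ :=
      Finset.filter_eq_empty_iff.2 fun w hw hwI => h ⟨w, hw, hwI⟩
    rw [hbelow, Finset.card_empty, zero_mul, zero_add]
    exact hE.card_filter_seqExt_le hI

lemma IsAdmissible.weight_filter_ssubset_lt_kappa (hG : G.PerfectRecall)
    (hE : G.IsAdmissible i E) (hw : w ∈ G.seqs (some i)) :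
    G.weight i (E.filter (w ⊂ ·)) < G.kappa i w := by
  rcases (E.filter (w ⊂ ·)).eq_empty_or_nonempty with h | h
  · rw [h]
    exact kappa_pos w
  · have hF := hE.mono (Finset.filter_subset _ _) h
    rw [weight_eq_sum_infoSets hG hF.1 hF.2.2.1, kappa, Nat.lt_succ_iff, Finset.sum_filter]
    refine Finset.sum_le_sum fun I hI => ?_
    split_ifs with hwI
    · exact hF.card_mul_add_card_le hG hI
    · have hbelow : (E.filter (w ⊂ ·)).filter (fun u => u ⊆ G.seqTo (some i) I) = ∅ :=
        Finset.filter_eq_empty_iff.2 fun u hu huI =>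
          hwI ((Finset.mem_filter.1 hu).2.subset.trans huI)
      have hat : (G.infoActions I).filter (fun a => G.seqExt (some i) I a ∈ E.filter (w ⊂ ·)) = ∅ :=
        Finset.filter_eq_empty_iff.2 fun a _ ha =>
          hwI (subset_seqTo_of_ssubset hG hw (Finset.mem_filter.1 ha).2)
      rw [hbelow, hat, Finset.card_empty, Finset.card_empty, zero_mul, zero_add]

lemma IsAdmissible.weight_lt_kappa (hG : G.PerfectRecall) (hE : G.IsAdmissible i E) :
    G.weight i E < G.kappa i ∅ := by
  have h := hE.weight_filter_ssubset_lt_kappa hG (empty_mem_seqs _)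
  rwa [Finset.filter_true_of_mem fun u hu => Finset.empty_ssubset.2 <|
    Finset.nonempty_iff_ne_empty.2 (ne_of_mem_of_not_mem hu hE.2.2.1)] at h

end Weights

section Cuts

variable {I : Finset (List A)} {a : A} {t : ℝ} {v w : MoveSet A} {E : Finset (MoveSet A)}
  {ℓ : Finset (List A) × A → ℝ}

variable (G) in
/-- The cut at level `t`: the minimal sequences among those with loss at least `t`. -/
def cut (i : N) (ℓ : Finset (List A) × A → ℝ) (t : ℝ) : Finset (MoveSet A) :=
  (G.seqs (some i)).filter fun w =>
    t ≤ lossOf ℓ w ∧ ∀ v ∈ G.seqs (some i), v ⊂ w → lossOf ℓ v < t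

lemma cut_subset_seqs (t : ℝ) : G.cut i ℓ t ⊆ G.seqs (some i) := Finset.filter_subset _ _

lemma le_lossOf_of_mem_cut (hw : w ∈ G.cut i ℓ t) : t ≤ lossOf ℓ w := (Finset.mem_filter.1 hw).2.1

lemma not_ssubset_of_mem_cut (hv : v ∈ G.cut i ℓ t) (hw : w ∈ G.cut i ℓ t) : ¬ w ⊂ v := fun h =>
  (le_lossOf_of_mem_cut hw).not_gt ((Finset.mem_filter.1 hv).2.2 w (cut_subset_seqs t hw) h)

lemma exists_mem_cut_subset (hw : w ∈ G.seqs (some i)) (ht : t ≤ lossOf ℓ w) :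
    ∃ u ∈ G.cut i ℓ t, u ⊆ w := by
  obtain ⟨u, huw, hmin⟩ := ((G.seqs (some i)).filter (t ≤ lossOf ℓ ·)).exists_le_minimal
    (Finset.mem_filter.2 ⟨hw, ht⟩)
  obtain ⟨hu, htu⟩ := Finset.mem_filter.1 hmin.1
  exact ⟨u, Finset.mem_filter.2 ⟨hu, htu, fun v hv hvu => not_le.1 fun htv =>
    hmin.not_lt (Finset.mem_filter.2 ⟨hv, htv⟩) hvu⟩, huw⟩

lemma empty_mem_cut : ∅ ∈ G.cut i ℓ t ↔ t ≤ 0 := by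
  simp [cut, empty_mem_seqs, lossOf_empty, Finset.not_ssubset_empty]

lemma cut_zero : G.cut i ℓ 0 = {∅} := by
  have hempty : ∅ ∈ G.cut i ℓ 0 := empty_mem_cut.2 le_rfl
  refine Finset.eq_singleton_iff_unique_mem.2 ⟨hempty, fun w hw => ?_⟩
  by_contra hne
  exact not_ssubset_of_mem_cut hw hempty
    (Finset.empty_ssubset.2 (Finset.nonempty_iff_ne_empty.2 hne))

lemma seqExt_mem_cut (hG : G.PerfectRecall) (hℓ : G.IsLoss i ℓ) (hI : I ∈ G.infoSets (some i))
    (ha : a ∈ G.infoActions I) : G.seqExt (some i) I a ∈ G.cut i ℓ t ↔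
      lossOf ℓ (G.seqTo (some i) I) < t ∧ t ≤ lossOf ℓ (G.seqExt (some i) I a) := by
  simp only [cut, Finset.mem_filter, seqExt_mem_seqs hG hI ha, true_and]
  rw [and_comm]
  refine and_congr_left fun _ => ⟨fun h => ?_, fun h v hv hlt => ?_⟩
  · exact h _ (seqTo_mem_seqs hG hI) (seqTo_ssubset_seqExt hG hI a)
  · exact (lossOf_mono hℓ (seqTo_mem_seqs hG hI) (subset_seqTo_of_ssubset hG hv hlt)).trans_lt h

lemma cut_admissible (hG : G.PerfectRecall) (hℓ : G.IsLoss i ℓ) (ht : 0 < t)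
    (hw : w ∈ G.seqs (some i)) (htw : t ≤ lossOf ℓ w) : G.IsAdmissible i (G.cut i ℓ t) := by
  obtain ⟨u, hu, -⟩ := exists_mem_cut_subset hw htw
  refine ⟨cut_subset_seqs t, ⟨u, hu⟩, fun h => ht.not_ge (empty_mem_cut.1 h), fun I hI h => ?_,
    fun v hv w hw => not_ssubset_of_mem_cut hv hw⟩
  -- The extension by a lossless action has the same loss as the sequence it extends.
  obtain ⟨a, ha, ha0⟩ := (hℓ I hI).2
  have hmem := (seqExt_mem_cut hG hℓ hI ha).1 (h (Finset.mem_image_of_mem _ ha))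
  rw [lossOf_seqExt hG hI, ha0, add_zero] at hmem
  exact hmem.1.not_ge hmem.2

lemma weight_le_sum_cut (hE : E ⊆ G.seqs (some i)) (hEt : ∀ w ∈ E, t ≤ lossOf ℓ w) :
    G.weight i E ≤ ∑ u ∈ G.cut i ℓ t, G.weight i (E.filter (u ⊆ ·)) := by
  calc G.weight i E ≤ ∑ w ∈ E, ∑ u ∈ G.cut i ℓ t with u ⊆ w, G.kappa i w := by
        refine Finset.sum_le_sum fun w hw => ?_
        obtain ⟨u, hu, huw⟩ := exists_mem_cut_subset (hE hw) (hEt w hw)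
        exact Finset.single_le_sum (f := fun _ => G.kappa i w) (fun _ _ => Nat.zero_le _)
          (Finset.mem_filter.2 ⟨hu, huw⟩)
    _ = ∑ u ∈ G.cut i ℓ t, G.weight i (E.filter (u ⊆ ·)) := by
        refine Finset.sum_comm' fun w u => ?_
        simp only [Finset.mem_filter]
        tauto

lemma IsAdmissible.weight_lt_or_eq_cut (hG : G.PerfectRecall) (hE : G.IsAdmissible i E)
    (hEt : ∀ w ∈ E, t ≤ lossOf ℓ w) :
    G.weight i E < G.weight i (G.cut i ℓ t) ∨ E = G.cut i ℓ t := by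
  have eq_of_mem {u e} (hu : u ∈ E) (he : e ∈ E) (hue : u ⊆ e) : e = u :=
    (hue.eq_of_not_ssubset (hE.2.2.2.2 e he u hu)).symm
  have above_of_mem {u} (hu : u ∈ E) : G.weight i (E.filter (u ⊆ ·)) = G.kappa i u := by
    have hsingle : E.filter (u ⊆ ·) = {u} := Finset.eq_singleton_iff_unique_mem.2
      ⟨Finset.mem_filter.2 ⟨hu, Finset.Subset.refl u⟩,
        fun e he => eq_of_mem hu (Finset.mem_filter.1 he).1 (Finset.mem_filter.1 he).2⟩
    rw [hsingle, weight, Finset.sum_singleton]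
  have above_of_notMem {u} (hu : u ∈ G.cut i ℓ t) (huE : u ∉ E) :
      G.weight i (E.filter (u ⊆ ·)) < G.kappa i u := by
    rw [Finset.filter_congr fun e he => ⟨fun h : u ⊆ e =>
      h.ssubset_of_ne (ne_of_mem_of_not_mem he huE).symm, fun h : u ⊂ e => h.subset⟩]
    exact hE.weight_filter_ssubset_lt_kappa hG (cut_subset_seqs t hu)
  by_cases hsub : G.cut i ℓ t ⊆ E
  · refine Or.inr (Finset.Subset.antisymm (fun e he => ?_) hsub)
    obtain ⟨u, hu, hue⟩ := exists_mem_cut_subset (hE.1 he) (hEt e he)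
    exact eq_of_mem (hsub hu) he hue ▸ hu
  · obtain ⟨u, hu, huE⟩ := Finset.not_subset.1 hsub
    refine Or.inl ((weight_le_sum_cut hE.1 hEt).trans_lt
      (Finset.sum_lt_sum (fun v hv => ?_) ⟨u, hu, above_of_notMem hu huE⟩))
    by_cases hvE : v ∈ E
    · exact (above_of_mem hvE).le
    · exact (above_of_notMem hv hvE).le

variable (G) in
/-- The rank of a sequence: the weight of the cut at its loss.  It is at the same time the index
of the perturbation that bounds the probability of this cut and a reversed ranking of the
losses. -/
def lossRank (i : N) (ℓ : Finset (List A) × A → ℝ) (w : MoveSet A) : ℕ :=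
  G.weight i (G.cut i ℓ (lossOf ℓ w))

lemma lossRank_pos (hw : w ∈ G.seqs (some i)) : 0 < G.lossRank i ℓ w := by
  obtain ⟨u, hu, -⟩ := exists_mem_cut_subset hw (le_refl (lossOf ℓ w))
  exact Finset.sum_pos (fun w _ => kappa_pos w) ⟨u, hu⟩

lemma lossRank_of_lossOf_eq_zero (hw : lossOf ℓ w = 0) : G.lossRank i ℓ w = G.kappa i ∅ := by
  rw [lossRank, hw, cut_zero, weight, Finset.sum_singleton]

lemma lossRank_lt_lossRank (hG : G.PerfectRecall) (hℓ : G.IsLoss i ℓ) (hv : v ∈ G.seqs (some i))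
    (hw : w ∈ G.seqs (some i)) (hvw : lossOf ℓ v < lossOf ℓ w) :
    G.lossRank i ℓ w < G.lossRank i ℓ v := by
  have hC := cut_admissible hG hℓ ((lossOf_nonneg hℓ hv).trans_lt hvw) hw le_rfl
  refine (hC.weight_lt_or_eq_cut hG fun u hu =>
    hvw.le.trans (le_lossOf_of_mem_cut hu)).resolve_right fun heq => ?_
  obtain ⟨u, hu, huv⟩ := exists_mem_cut_subset hv (le_refl (lossOf ℓ v))
  exact hvw.not_ge ((le_lossOf_of_mem_cut (heq ▸ hu)).trans (lossOf_mono hℓ hv huv))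

lemma lossRank_le_lossRank_iff (hG : G.PerfectRecall) (hℓ : G.IsLoss i ℓ)
    (hv : v ∈ G.seqs (some i)) (hw : w ∈ G.seqs (some i)) :
    G.lossRank i ℓ v ≤ G.lossRank i ℓ w ↔ lossOf ℓ w ≤ lossOf ℓ v := by
  refine ⟨fun h => ?_, fun h => ?_⟩
  · contrapose! h
    exact lossRank_lt_lossRank hG hℓ hv hw h
  · rcases h.eq_or_lt with h | h
    · rw [lossRank, lossRank, h]
    · exact (lossRank_lt_lossRank hG hℓ hw hv h).le

lemma lossRank_le_kappa (hG : G.PerfectRecall) (hℓ : G.IsLoss i ℓ) (hw : w ∈ G.seqs (some i)) :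
    G.lossRank i ℓ w ≤ G.kappa i ∅ := by
  rw [← lossRank_of_lossOf_eq_zero (ℓ := ℓ) lossOf_empty,
    lossRank_le_lossRank_iff hG hℓ hw (empty_mem_seqs _), lossOf_empty]
  exact lossOf_nonneg hℓ hw

lemma lossRank_lt_kappa (hG : G.PerfectRecall) (hℓ : G.IsLoss i ℓ) (hw : w ∈ G.seqs (some i))
    (hw0 : 0 < lossOf ℓ w) : G.lossRank i ℓ w < G.kappa i ∅ :=
  (cut_admissible hG hℓ hw0 hw le_rfl).weight_lt_kappa hG

end Cuts

section Constraints

variable {I : Finset (List A)} {a b : A} {t : ℝ} {w : MoveSet A} {x : MoveSet A → ℝ}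
  {ℓ : Finset (List A) × A → ℝ}

lemma le_sum_cut (hG : G.PerfectRecall) (hx : x ∈ G.plans i) (hw : w ∈ G.seqs (some i))
    (htw : t ≤ lossOf ℓ w) : x w ≤ ∑ u ∈ G.cut i ℓ t, x u := by
  obtain ⟨u, hu, huw⟩ := exists_mem_cut_subset hw htw
  exact (plan_antitone hG hx (cut_subset_seqs t hu) hw huw).trans
    (Finset.single_le_sum (f := x) (fun v _ => plan_nonneg hG hx v) hu)

lemma IsAdmissible.le_sum_of_le_sum_cut (hG : G.PerfectRecall)
    (hx : x ∈ G.plans i) {S : ℕ → ℝ}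
    (hS : ∀ w ∈ G.seqs (some i), ∀ q < G.lossRank i ℓ w, S q ≤ x w)
    (hcut : ∀ w ∈ G.seqs (some i), 0 < lossOf ℓ w →
      S (G.lossRank i ℓ w) ≤ ∑ u ∈ G.cut i ℓ (lossOf ℓ w), x u)
    {E : Finset (MoveSet A)} (hE : G.IsAdmissible i E) : S (G.weight i E) ≤ ∑ w ∈ E, x w := by
  obtain ⟨w, hw, hmin⟩ := Finset.exists_min_image E (lossOf ℓ) hE.2.1
  rcases hE.weight_lt_or_eq_cut hG hmin with hlt | heq
  · exact (hS w (hE.1 hw) _ hlt).trans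
      (Finset.single_le_sum (f := x) (fun v _ => plan_nonneg hG hx v) hw)
  · have hpos : 0 < lossOf ℓ w := not_le.1 fun h => hE.2.2.1 (heq ▸ empty_mem_cut.2 h)
    rw [heq]
    exact hcut w (hE.1 hw) hpos

lemma insert_cut_admissible (hG : G.PerfectRecall) (hℓ : G.IsLoss i ℓ)
    (hC : G.IsAdmissible i (G.cut i ℓ t)) (hI : I ∈ G.infoSets (some i))
    (ha : a ∈ G.infoActions I) (hb : b ∈ G.infoActions I) (hba : b ≠ a)
    (hbt : G.seqExt (some i) I b ∉ G.cut i ℓ t) (hlt : lossOf ℓ (G.seqExt (some i) I a) < t) :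
    G.IsAdmissible i (insert (G.seqExt (some i) I a)
      ((G.cut i ℓ t).filter (¬ G.seqExt (some i) I a ⊆ ·))) := by
  have hw := seqExt_mem_seqs hG hI ha
  set w := G.seqExt (some i) I a with hwI
  have hnot {u} (hu : u ∈ G.cut i ℓ t) : ¬ u ⊆ w := fun huw =>
    hlt.not_ge ((le_lossOf_of_mem_cut hu).trans (lossOf_mono hℓ hw huw))
  simp only [IsAdmissible, Finset.insert_subset_iff, Finset.insert_nonempty, Finset.mem_insert,
    Finset.mem_filter, true_and]
  refine ⟨⟨hw, (Finset.filter_subset _ _).trans (cut_subset_seqs t)⟩, ?_, fun J hJ h => ?_, ?_⟩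
  · rintro (h | h)
    · exact seqExt_ne_empty _ I a h.symm
    · exact hC.2.2.1 h.1
  · rcases eq_or_ne J I with rfl | hJI
    · rcases Finset.mem_insert.1 (h (Finset.mem_image_of_mem _ hb)) with h | h
      · exact hba (seqExt_inj hG hI h).2
      · exact hbt (Finset.mem_filter.1 h).1
    · refine hC.2.2.2.1 J hJ (Finset.image_subset_iff.2 fun c hc => ?_)
      rcases Finset.mem_insert.1 (h (Finset.mem_image_of_mem _ hc)) with h | h
      · exact absurd (seqExt_inj hG hI h).1 hJI
      · exact (Finset.mem_filter.1 h).1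
  · rintro u (rfl | hu) v (rfl | hv) h
    · exact h.ne rfl
    · exact hnot hv.1 h.subset
    · exact hu.2 h.subset
    · exact not_ssubset_of_mem_cut hu.1 hv.1 h

lemma weight_cut_lt_weight_insert (hG : G.PerfectRecall) (hC : G.IsAdmissible i (G.cut i ℓ t))
    (hw : w ∈ G.seqs (some i)) (hlt : lossOf ℓ w < t) :
    G.weight i (G.cut i ℓ t) < G.weight i (insert w ((G.cut i ℓ t).filter (¬ w ⊆ ·))) := by
  have hne {u} (hu : u ∈ G.cut i ℓ t) : w ≠ u := fun h =>
    hlt.not_ge (h ▸ le_lossOf_of_mem_cut hu)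
  have habove : G.weight i ((G.cut i ℓ t).filter (w ⊆ ·)) < G.kappa i w := by
    rw [Finset.filter_congr fun u hu => ⟨fun h : w ⊆ u => h.ssubset_of_ne (hne hu),
      fun h : w ⊂ u => h.subset⟩]
    exact hC.weight_filter_ssubset_lt_kappa hG hw
  rw [weight, weight, Finset.sum_insert (by simp), ← Finset.sum_filter_add_sum_filter_not _ (w ⊆ ·)]
  exact Nat.add_lt_add_right habove _

lemma le_add_sum_cut (hG : G.PerfectRecall) (hℓ : G.IsLoss i ℓ) (hx : x ∈ G.plans i)
    (hC : G.IsAdmissible i (G.cut i ℓ t)) {ρ : ℝ} (hρ : ρ ≤ 1)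
    (hρE : ∀ E, G.IsAdmissible i E → G.weight i (G.cut i ℓ t) < G.weight i E → ρ ≤ ∑ u ∈ E, x u)
    (hw : w ∈ G.seqs (some i)) (hlt : lossOf ℓ w < t) :
    ρ ≤ x w + ∑ u ∈ G.cut i ℓ t with ¬ w ⊆ u, x u := by
  revert hlt
  refine seqs_induction hG
    (P := fun w => lossOf ℓ w < t → ρ ≤ x w + ∑ u ∈ G.cut i ℓ t with ¬ w ⊆ u, x u) ?_
    (fun I hI a ha ih hlt => ?_) hw
  · intro _
    rw [hx.1]
    exact hρ.trans (le_add_of_nonneg_right (Finset.sum_nonneg fun u _ => plan_nonneg hG hx u))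
  by_cases hex : ∃ b ∈ G.infoActions I, b ≠ a ∧ G.seqExt (some i) I b ∉ G.cut i ℓ t
  · obtain ⟨b, hb, hba, hbt⟩ := hex
    have hle := hρE _ (insert_cut_admissible hG hℓ hC hI ha hb hba hbt hlt)
      (weight_cut_lt_weight_insert hG hC (seqExt_mem_seqs hG hI ha) hlt)
    rwa [Finset.sum_insert (by simp)] at hle
  -- All other actions at `I` lead into the cut, so `x (seqTo I)` splits along the actions.
  push Not at hex
  refine (ih ((lossOf_mono hℓ (seqExt_mem_seqs hG hI ha)
    (seqTo_subset_seqExt _ I a)).trans_lt hlt)).trans ?_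
  rw [← hx.2.1 I hI, ← Finset.add_sum_erase _ _ ha, add_assoc,
    ← Finset.sum_image (f := x) (g := G.seqExt (some i) I)
      fun b _ c _ h => (seqExt_inj hG hI h).2, ← Finset.sum_union]
  · refine add_le_add_right (Finset.sum_le_sum_of_subset_of_nonneg (Finset.union_subset ?_ ?_)
      fun u _ _ => plan_nonneg hG hx u) _
    · refine Finset.image_subset_iff.2 fun b hb => ?_
      obtain ⟨hba, hb⟩ := Finset.mem_erase.1 hb
      exact Finset.mem_filter.2 ⟨hex b hb hba, fun hsub => hba <| action_unique hG
        (seqExt_mem_seqs hG hI hb) (mem_seqExt_self _ I b) (hsub (mem_seqExt_self _ I a))⟩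
    · exact Finset.monotone_filter_right _ fun u _ h hsub =>
        h ((seqTo_subset_seqExt _ I a).trans hsub)
  · refine Finset.disjoint_left.2 fun u hu hu' => (Finset.mem_filter.1 hu').2 ?_
    obtain ⟨b, -, rfl⟩ := Finset.mem_image.1 hu
    exact seqTo_subset_seqExt _ I b

end Constraints

/-! ### Decomposition of the expected loss -/

section Levels

variable {t : ℝ} {w : MoveSet A} {x z : MoveSet A → ℝ} {ℓ : Finset (List A) × A → ℝ}

variable (G) in
/-- The positive losses of the sequences of player `i`. -/
def lossLevels (i : N) (ℓ : Finset (List A) × A → ℝ) : Finset ℝ :=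
  ((G.seqs (some i)).image (lossOf ℓ)).filter (0 < ·)

lemma mem_lossLevels :
    t ∈ G.lossLevels i ℓ ↔ (∃ w ∈ G.seqs (some i), lossOf ℓ w = t) ∧ 0 < t := by
  rw [lossLevels, Finset.mem_filter, Finset.mem_image]

lemma exists_lossLevels_weights (hG : G.PerfectRecall) (hℓ : G.IsLoss i ℓ) :
    ∃ c : ℝ → ℝ, (∀ t ∈ G.lossLevels i ℓ, 0 < c t) ∧
      (∀ w ∈ G.seqs (some i), ∑ t ∈ G.lossLevels i ℓ with t ≤ lossOf ℓ w, c t = lossOf ℓ w) ∧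
        ∀ m ∈ G.moves i,
          ∑ t ∈ G.lossLevels i ℓ with G.seqExt (some i) m.1 m.2 ∈ G.cut i ℓ t, c t = ℓ m := by
  obtain ⟨c, hc⟩ := exists_increments (G.lossLevels i ℓ) id
  have hsum : ∀ w ∈ G.seqs (some i),
      ∑ t ∈ G.lossLevels i ℓ with t ≤ lossOf ℓ w, c t = lossOf ℓ w := by
    intro w hw
    rcases (lossOf_nonneg hℓ hw).eq_or_lt with h | h
    · rw [← h]
      exact Finset.sum_eq_zero fun t ht => absurd (Finset.mem_filter.1 ht).2
        (mem_lossLevels.1 (Finset.mem_filter.1 ht).1).2.not_ge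
    · exact (hc _ (mem_lossLevels.2 ⟨⟨w, hw, rfl⟩, h⟩)).1
  refine ⟨c, fun t ht => ?_, hsum, fun m hm => ?_⟩
  · rcases (hc t ht).2 with h | ⟨r, -, hrt, h⟩
    · exact h ▸ (mem_lossLevels.1 ht).2
    · exact h ▸ sub_pos.2 hrt
  · obtain ⟨hI, ha⟩ := mem_moves.1 hm
    have hext := lossOf_seqExt (ℓ := ℓ) hG hI m.2
    have hle : lossOf ℓ (G.seqTo (some i) m.1) ≤ lossOf ℓ (G.seqExt (some i) m.1 m.2) :=
      hext ▸ le_add_of_nonneg_right (hℓ.nonneg hm)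
    have hsplit := hsum _ (seqExt_mem_seqs hG hI ha)
    rw [← Finset.sum_filter_add_sum_filter_not _ (· ≤ lossOf ℓ (G.seqTo (some i) m.1)),
      Finset.filter_filter, Finset.filter_filter, Finset.filter_congr fun t _ =>
        and_iff_right_of_imp fun h => h.trans hle, hsum _ (seqTo_mem_seqs hG hI), hext,
      add_right_inj] at hsplit
    rw [← hsplit]
    refine Finset.sum_congr (Finset.filter_congr fun t _ => ?_) fun _ _ => rfl
    rw [seqExt_mem_cut hG hℓ hI ha, not_le, hext, and_comm]

lemma cost_eq_sum_cut (hG : G.PerfectRecall) {c : ℝ → ℝ}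
    (hc : ∀ m ∈ G.moves i,
      ∑ t ∈ G.lossLevels i ℓ with G.seqExt (some i) m.1 m.2 ∈ G.cut i ℓ t, c t = ℓ m)
    (x : MoveSet A → ℝ) :
    G.cost i ℓ x = ∑ t ∈ G.lossLevels i ℓ, c t * ∑ u ∈ G.cut i ℓ t, x u := by
  calc G.cost i ℓ x
      = ∑ m ∈ G.moves i, ∑ t ∈ G.lossLevels i ℓ with G.seqExt (some i) m.1 m.2 ∈ G.cut i ℓ t,
          c t * x (G.seqExt (some i) m.1 m.2) := by
        refine Finset.sum_congr rfl fun m hm => ?_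
        rw [← Finset.sum_mul, hc m hm, mul_comm]
    _ = ∑ t ∈ G.lossLevels i ℓ, ∑ m ∈ G.moves i with G.seqExt (some i) m.1 m.2 ∈ G.cut i ℓ t,
          c t * x (G.seqExt (some i) m.1 m.2) := by
        refine Finset.sum_comm' fun m t => ?_
        simp only [Finset.mem_filter]
        tauto
    _ = ∑ t ∈ G.lossLevels i ℓ, c t * ∑ u ∈ G.cut i ℓ t, x u := by
        refine Finset.sum_congr rfl fun t ht => ?_
        rw [← Finset.mul_sum, sum_of_subset_seqs hG (cut_subset_seqs t) fun h =>
          (mem_lossLevels.1 ht).2.not_ge (empty_mem_cut.1 h)]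

lemma cost_le_cost (hG : G.PerfectRecall) (hℓ : G.IsLoss i ℓ)
    (h : ∀ t ∈ G.lossLevels i ℓ, ∑ u ∈ G.cut i ℓ t, x u ≤ ∑ u ∈ G.cut i ℓ t, z u) :
    G.cost i ℓ x ≤ G.cost i ℓ z := by
  obtain ⟨c, hcpos, -, hc⟩ := exists_lossLevels_weights hG hℓ
  rw [cost_eq_sum_cut hG hc, cost_eq_sum_cut hG hc]
  exact Finset.sum_le_sum fun t ht => mul_le_mul_of_nonneg_left (h t ht) (hcpos t ht).le

lemma sum_cut_eq_of_cost_le_sum (hG : G.PerfectRecall) (hℓ : G.IsLoss i ℓ) {τ : MoveSet A → ℝ}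
    (hle : ∀ t ∈ G.lossLevels i ℓ,
      ∑ v ∈ G.seqs (some i) with t ≤ lossOf ℓ v, τ v ≤ ∑ u ∈ G.cut i ℓ t, x u)
    (hcost : G.cost i ℓ x ≤ ∑ v ∈ G.seqs (some i), τ v * lossOf ℓ v)
    (ht : t ∈ G.lossLevels i ℓ) :
    ∑ u ∈ G.cut i ℓ t, x u = ∑ v ∈ G.seqs (some i) with t ≤ lossOf ℓ v, τ v := by
  obtain ⟨c, hcpos, hcsum, hc⟩ := exists_lossLevels_weights hG hℓ
  have hτ : ∑ v ∈ G.seqs (some i), τ v * lossOf ℓ v =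
      ∑ t ∈ G.lossLevels i ℓ, c t * ∑ v ∈ G.seqs (some i) with t ≤ lossOf ℓ v, τ v := by
    calc _ = ∑ v ∈ G.seqs (some i), ∑ t ∈ G.lossLevels i ℓ with t ≤ lossOf ℓ v, c t * τ v := by
          refine Finset.sum_congr rfl fun v hv => ?_
          rw [← Finset.sum_mul, hcsum v hv, mul_comm]
      _ = ∑ t ∈ G.lossLevels i ℓ, ∑ v ∈ G.seqs (some i) with t ≤ lossOf ℓ v, c t * τ v := by
          refine Finset.sum_comm' fun v t => ?_
          simp only [Finset.mem_filter]
          tauto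
      _ = _ := by simp only [Finset.mul_sum]
  have hmul : ∀ t ∈ G.lossLevels i ℓ,
      c t * ∑ v ∈ G.seqs (some i) with t ≤ lossOf ℓ v, τ v ≤ c t * ∑ u ∈ G.cut i ℓ t, x u :=
    fun t ht => mul_le_mul_of_nonneg_left (hle t ht) (hcpos t ht).le
  rw [hτ, cost_eq_sum_cut hG hc] at hcost
  have heq := (Finset.sum_eq_sum_iff_of_le hmul).1 ((Finset.sum_le_sum hmul).antisymm hcost) t ht
  exact (mul_left_cancel₀ (hcpos t ht).ne' heq).symm

lemma exists_plan_of_weights (hG : G.PerfectRecall) (hℓ : G.IsLoss i ℓ) {τ : MoveSet A → ℝ}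
    (hτ : ∀ v ∈ G.seqs (some i), 0 ≤ τ v) (hτ1 : ∑ v ∈ G.seqs (some i), τ v = 1) :
    ∃ y ∈ G.plans i, (∀ w ∈ G.seqs (some i), τ w ≤ y w) ∧
      (∀ t, ∑ v ∈ G.seqs (some i) with t ≤ lossOf ℓ v, τ v ≤ ∑ u ∈ G.cut i ℓ t, y u) ∧
        G.cost i ℓ y = ∑ v ∈ G.seqs (some i), τ v * lossOf ℓ v := by
  choose! e he hev hcost using fun v (hv : v ∈ G.seqs (some i)) => exists_plan_cost_eq hG hℓ hv
  have hnonneg {v} (hv : v ∈ G.seqs (some i)) (w) : 0 ≤ τ v * e v w :=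
    mul_nonneg (hτ v hv) (plan_nonneg hG (he v hv) w)
  refine ⟨_, sum_mul_mem_plans hτ hτ1 he, fun w hw => ?_, fun t => ?_, ?_⟩
  · calc τ w = τ w * e w w := by rw [hev w hw, mul_one]
      _ ≤ ∑ v ∈ G.seqs (some i), τ v * e v w :=
        Finset.single_le_sum (f := fun v => τ v * e v w) (fun v hv => hnonneg hv w) hw
  · rw [Finset.sum_comm, Finset.sum_filter]
    refine Finset.sum_le_sum fun v hv => ?_
    split_ifs with hvt
    · rw [← Finset.mul_sum]
      exact le_mul_of_one_le_right (hτ v hv) ((hev v hv).ge.trans (le_sum_cut hG (he v hv) hv hvt))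
    · exact Finset.sum_nonneg fun u _ => hnonneg hv u
  · calc _ = ∑ v ∈ G.seqs (some i), τ v * G.cost i ℓ (e v) := by
          simp only [cost, Finset.sum_mul, Finset.mul_sum, mul_assoc]
          exact Finset.sum_comm
      _ = _ := Finset.sum_congr rfl fun v hv => by rw [hcost v hv]

end Levels

/-! ### Perturbation vectors -/

section Perturb

variable {d : ℕ → ℝ} {ε : ℝ} {l q : ℕ}

lemma perturb_pos (hd : ∀ l ∈ Finset.Icc 1 (G.kappa i ∅), 0 < d l) (l : ℕ) :
    0 < G.perturb i d l :=
  Finset.prod_pos fun q hq => hd q (Finset.Icc_subset_Icc_right (Nat.sub_le _ _) hq)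

lemma perturb_le_one (hd : ∀ l ∈ Finset.Icc 1 (G.kappa i ∅), 0 < d l ∧ d l ≤ 1) (l : ℕ) :
    G.perturb i d l ≤ 1 :=
  have hsub := Finset.Icc_subset_Icc_right (a := 1) (Nat.sub_le (G.kappa i ∅) l)
  Finset.prod_le_one (fun q hq => (hd q (hsub hq)).1.le) fun q hq => (hd q (hsub hq)).2

lemma perturb_of_le (hl : G.kappa i ∅ ≤ l) : G.perturb i d l = 1 := by
  simp [perturb, Nat.sub_eq_zero_of_le hl]

lemma perturb_succ (hl : l < G.kappa i ∅) :
    G.perturb i d l = G.perturb i d (l + 1) * d (G.kappa i ∅ - l) := by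
  rw [perturb, perturb, ← Nat.sub_sub]
  conv_lhs => rw [← Nat.sub_add_cancel (Nat.sub_pos_of_lt hl)]
  rw [Finset.prod_Icc_succ_top (Nat.succ_le_succ (Nat.zero_le _)),
    Nat.sub_add_cancel (Nat.sub_pos_of_lt hl)]

lemma perturb_le (hd : ∀ l ∈ Finset.Icc 1 (G.kappa i ∅), 0 < d l ∧ d l ≤ ε)
    (hl : l < G.kappa i ∅) : G.perturb i d l ≤ ε * G.perturb i d (l + 1) := by
  rw [perturb_succ hl, mul_comm]
  exact mul_le_mul_of_nonneg_right
    (hd _ (Finset.mem_Icc.2 ⟨Nat.sub_pos_of_lt hl, Nat.sub_le _ _⟩)).2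
    (perturb_pos (fun l hl => (hd l hl).1) _).le

variable (G) in
/-- The lower bound that the perturbation vector `d` imposes on the probability of an admissible
set of weight `q`. -/
def perturbSum (i : N) (d : ℕ → ℝ) (q : ℕ) : ℝ := ∑ l ∈ Finset.Icc 1 q, G.perturb i d l

lemma perturbSum_zero (d : ℕ → ℝ) : G.perturbSum i d 0 = 0 := Finset.sum_empty

lemma perturbSum_succ (d : ℕ → ℝ) (q : ℕ) :
    G.perturbSum i d (q + 1) = G.perturbSum i d q + G.perturb i d (q + 1) :=
  Finset.sum_Icc_succ_top (Nat.succ_le_succ (Nat.zero_le _)) _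

lemma perturbSum_mono (hd : ∀ l ∈ Finset.Icc 1 (G.kappa i ∅), 0 < d l) :
    Monotone (G.perturbSum i d) := fun _ _ h =>
  Finset.sum_le_sum_of_subset_of_nonneg (Finset.Icc_subset_Icc_right h)
    fun l _ _ => (perturb_pos hd l).le

lemma perturbSum_nonneg (hd : ∀ l ∈ Finset.Icc 1 (G.kappa i ∅), 0 < d l) (q : ℕ) :
    0 ≤ G.perturbSum i d q :=
  Finset.sum_nonneg fun l _ => (perturb_pos hd l).le

lemma perturbSum_le (hε : 0 ≤ ε) (hε2 : ε ≤ 1 / 2)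
    (hd : ∀ l ∈ Finset.Icc 1 (G.kappa i ∅), 0 < d l ∧ d l ≤ ε)
    (hq : q < G.kappa i ∅) : G.perturbSum i d q ≤ 2 * ε * G.perturb i d (q + 1) := by
  have hpos := perturb_pos fun l hl => (hd l hl).1
  induction q with
  | zero =>
    rw [perturbSum_zero]
    exact mul_nonneg (mul_nonneg zero_le_two hε) (hpos _).le
  | succ q ih =>
    calc G.perturbSum i d (q + 1)
        ≤ 2 * ε * G.perturb i d (q + 1) + G.perturb i d (q + 1) := by
          rw [perturbSum_succ]
          exact add_le_add_left (ih (Nat.lt_of_succ_lt hq)) _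
      _ ≤ 2 * G.perturb i d (q + 1) := by nlinarith [hpos (q + 1)]
      _ ≤ 2 * (ε * G.perturb i d (q + 1 + 1)) :=
          mul_le_mul_of_nonneg_left (perturb_le hd hq) zero_le_two
      _ = 2 * ε * G.perturb i d (q + 1 + 1) := (mul_assoc _ _ _).symm

lemma exists_perturb_eq {r : ℕ → ℝ} (hr : ∀ l, 0 < r l) (hrκ : r (G.kappa i ∅) = 1)
    (hrε : ∀ l < G.kappa i ∅, r l ≤ ε * r (l + 1)) :
    ∃ d : ℕ → ℝ, (∀ l ∈ Finset.Icc 1 (G.kappa i ∅), 0 < d l ∧ d l ≤ ε) ∧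
      ∀ l ≤ G.kappa i ∅, G.perturb i d l = r l := by
  set κ := G.kappa i ∅
  refine ⟨fun q => r (κ - q) / r (κ - q + 1), fun l hl => ?_, fun l hl => ?_⟩
  · refine ⟨div_pos (hr _) (hr _), (div_le_iff₀ (hr _)).2 (hrε _ ?_)⟩
    obtain ⟨hl1, hlκ⟩ := Finset.mem_Icc.1 hl
    omega
  · induction hl using Nat.decreasingInduction with
    | self => rw [hrκ, perturb_of_le le_rfl]
    | of_succ l hlκ ih =>
      rw [perturb_succ hlκ, ih, Nat.sub_sub_self hlκ.le]
      exact mul_div_cancel₀ _ (hr _).ne'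

lemma exists_perturbSum_eq {S : ℕ → ℝ} (hε : 0 ≤ ε) (hε1 : ε ≤ 1) (hS : ∀ q, 0 < S q)
    (hSκ : S (G.kappa i ∅) = 1) (hSε : ∀ q, S q ≤ ε / 2 * S (q + 1)) :
    ∃ d : ℕ → ℝ, (∀ l ∈ Finset.Icc 1 (G.kappa i ∅), 0 < d l ∧ d l ≤ ε) ∧
      ∀ q, 0 < q → q < G.kappa i ∅ → G.perturbSum i d q = S q := by
  obtain ⟨r, hr, hrκ, hsum⟩ := exists_comparable_increments hS (fun q => (hSε q).trans
    (by nlinarith [hS (q + 1)])) hSκ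
  obtain ⟨d, hd, hdr⟩ := exists_perturb_eq (ε := ε)
    (fun l => (half_pos (hS l)).trans_le (hr l).1) hrκ fun l _ => by
      calc r l ≤ S l := (hr l).2
        _ ≤ ε * (S (l + 1) / 2) := (hSε l).trans_eq (by ring)
        _ ≤ ε * r (l + 1) := mul_le_mul_of_nonneg_left (hr _).1 hε
  refine ⟨d, hd, fun q hq hqκ => ?_⟩
  rw [← hsum q hq hqκ]
  exact Finset.sum_congr rfl fun l hl => hdr l ((Finset.mem_Icc.1 hl).2.trans hqκ.le)

lemma exists_monotone_extension_perturbSum (hε : 0 ≤ ε) (hε4 : ε ≤ 1 / 4)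
    (hd : ∀ l ∈ Finset.Icc 1 (G.kappa i ∅), 0 < d l ∧ d l ≤ ε) :
    ∃ F : ℕ → ℝ, Monotone F ∧ (∀ q < G.kappa i ∅, F q = G.perturbSum i d q) ∧
      F (G.kappa i ∅) = 1 ∧ ∀ q < G.kappa i ∅, G.perturb i d (q + 1) / 2 ≤ F (q + 1) - F q := by
  have hd0 : ∀ l ∈ Finset.Icc 1 (G.kappa i ∅), 0 < d l := fun l hl => (hd l hl).1
  have le_half {q} (hq : q < G.kappa i ∅) : G.perturbSum i d q ≤ G.perturb i d (q + 1) / 2 := by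
    nlinarith [perturbSum_le hε (by linarith) hd hq, perturb_pos hd0 (q + 1)]
  have hle1 (l) : G.perturb i d l ≤ 1 :=
    perturb_le_one (fun l hl => ⟨hd0 l hl, (hd l hl).2.trans (by linarith)⟩) l
  set F : ℕ → ℝ := fun q => if q < G.kappa i ∅ then G.perturbSum i d q else 1
  have F_of_lt {q} (hq : q < G.kappa i ∅) : F q = G.perturbSum i d q := if_pos hq
  have F_of_le {q} (hq : G.kappa i ∅ ≤ q) : F q = 1 := if_neg hq.not_gt
  have hgap {q} (hq : q < G.kappa i ∅) : G.perturb i d (q + 1) / 2 ≤ F (q + 1) - F q := by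
    rcases lt_or_ge (q + 1) (G.kappa i ∅) with h | h
    · rw [F_of_lt hq, F_of_lt h, perturbSum_succ, add_sub_cancel_left]
      exact half_le_self (perturb_pos hd0 _).le
    · rw [F_of_lt hq, F_of_le h]
      linarith [le_half hq, hle1 (q + 1)]
  refine ⟨F, monotone_nat_of_le_succ fun q => ?_, fun q => F_of_lt, F_of_le le_rfl, fun q => hgap⟩
  rcases lt_or_ge q (G.kappa i ∅) with h | h
  · exact sub_nonneg.1 ((half_pos (perturb_pos hd0 _)).le.trans (hgap h))
  · rw [F_of_le h, F_of_le (h.trans q.le_succ)]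

end Perturb

/-! ### Ratios and optimality in the perturbed strategy space -/

section RatioToOptimal

variable {ε ε' : ℝ} {d : ℕ → ℝ} {v w : MoveSet A} {x : MoveSet A → ℝ}
  {ℓ : Finset (List A) × A → ℝ}

lemma sum_cut_le_card_mul (hG : G.PerfectRecall) (hx : x ∈ G.plans i) (hε : 0 ≤ ε)
    (hratio : ∀ v ∈ G.seqs (some i), ∀ w ∈ G.seqs (some i), lossOf ℓ w < lossOf ℓ v →
      x v ≤ ε * x w)
    (hw : w ∈ G.seqs (some i)) (hwv : lossOf ℓ w < lossOf ℓ v) :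
    ∑ u ∈ G.cut i ℓ (lossOf ℓ v), x u ≤ (G.seqs (some i)).card * ε * x w := by
  calc ∑ u ∈ G.cut i ℓ (lossOf ℓ v), x u
      ≤ (G.cut i ℓ (lossOf ℓ v)).card • (ε * x w) := Finset.sum_le_card_nsmul _ _ _ fun u hu =>
        hratio u (cut_subset_seqs _ hu) w hw (hwv.trans_le (le_lossOf_of_mem_cut hu))
    _ ≤ (G.seqs (some i)).card • (ε * x w) := nsmul_le_nsmul_left
        (mul_nonneg hε (plan_nonneg hG hx w)) (Finset.card_le_card (cut_subset_seqs _))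
    _ = (G.seqs (some i)).card * ε * x w := by rw [nsmul_eq_mul, mul_assoc]

lemma exists_perturbSum_eq_sum_cut (hG : G.PerfectRecall) (hℓ : G.IsLoss i ℓ) (hε : 0 ≤ ε)
    (hε' : 0 < ε') (hε'1 : ε' ≤ 1)
    (hεε' : (G.seqs (some i)).card * ε ≤ (ε' / 2) ^ G.kappa i ∅)
    (hx : x ∈ G.plans i) (hpos : ∀ w ∈ G.seqs (some i), 0 < x w)
    (hratio : ∀ v ∈ G.seqs (some i), ∀ w ∈ G.seqs (some i), lossOf ℓ w < lossOf ℓ v →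
      x v ≤ ε * x w) :
    ∃ d : ℕ → ℝ, (∀ l ∈ Finset.Icc 1 (G.kappa i ∅), 0 < d l ∧ d l ≤ ε') ∧
      (∀ w ∈ G.seqs (some i), ∀ q < G.lossRank i ℓ w, G.perturbSum i d q ≤ x w) ∧
      ∀ w ∈ G.seqs (some i), 0 < lossOf ℓ w →
        G.perturbSum i d (G.lossRank i ℓ w) = ∑ u ∈ G.cut i ℓ (lossOf ℓ w), x u := by
  have rank_le {w} (hw : w ∈ G.seqs (some i)) := lossRank_le_kappa hG hℓ hw
  obtain ⟨S, hSpos, hSε, hS⟩ := exists_geometric_growth (s := G.seqs (some i))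
    (n := G.lossRank i ℓ) (X := fun w => ∑ u ∈ G.cut i ℓ (lossOf ℓ w), x u) (μ := x)
    ⟨∅, empty_mem_seqs _⟩ (half_pos hε') (by linarith) (fun w => rank_le) hpos
    (fun w hw => le_sum_cut hG hx hw le_rfl)
    (fun v hv w hw h => by
      have hloss := ((lossRank_le_lossRank_iff hG hℓ hw hv).1 h.ge).antisymm
        ((lossRank_le_lossRank_iff hG hℓ hv hw).1 h.le)
      simp only [hloss])
    (fun v hv w hw h => by
      rw [← not_le, lossRank_le_lossRank_iff hG hℓ hw hv, not_le] at h
      exact (sum_cut_le_card_mul hG hx hε hratio hw h).trans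
        (mul_le_mul_of_nonneg_right hεε' (hpos w hw).le))
  have hSκ : S (G.kappa i ∅) = 1 := by
    have hS0 := (hS ∅ (empty_mem_seqs _)).1
    rwa [lossRank_of_lossOf_eq_zero lossOf_empty, lossOf_empty, cut_zero, Finset.sum_singleton,
      hx.1] at hS0
  obtain ⟨d, hd, hdS⟩ := exists_perturbSum_eq hε'.le hε'1 hSpos hSκ hSε
  refine ⟨d, hd, fun w hw q hq => ?_, fun w hw hw0 => ?_⟩
  · rcases q.eq_zero_or_pos with rfl | hq0
    · exact (perturbSum_zero d).trans_le (hpos w hw).le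
    · exact (hdS q hq0 (hq.trans_le (rank_le hw))).trans_le ((hS w hw).2 q hq)
  · exact (hdS _ (lossRank_pos hw) (lossRank_lt_kappa hG hℓ hw hw0)).trans (hS w hw).1

lemma mem_perturbedPlans_of_le_sum_cut (hG : G.PerfectRecall) (hx : x ∈ G.plans i)
    (hS : ∀ w ∈ G.seqs (some i), ∀ q < G.lossRank i ℓ w, G.perturbSum i d q ≤ x w)
    (hcut : ∀ w ∈ G.seqs (some i), 0 < lossOf ℓ w →
      G.perturbSum i d (G.lossRank i ℓ w) ≤ ∑ u ∈ G.cut i ℓ (lossOf ℓ w), x u) :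
    x ∈ G.perturbedPlans i d :=
  ⟨hx, fun _ hE => hE.le_sum_of_le_sum_cut hG hx hS hcut⟩

lemma perturbSum_le_sum_cut (hG : G.PerfectRecall) (hℓ : G.IsLoss i ℓ)
    (hx : x ∈ G.perturbedPlans i d) (hw : w ∈ G.seqs (some i)) (hw0 : 0 < lossOf ℓ w) :
    G.perturbSum i d (G.lossRank i ℓ w) ≤ ∑ u ∈ G.cut i ℓ (lossOf ℓ w), x u :=
  hx.2 _ (cut_admissible hG hℓ hw0 hw le_rfl)

lemma exists_perturbation_of_ratio (hG : G.PerfectRecall) (hℓ : G.IsLoss i ℓ) (hε : 0 ≤ ε)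
    (hε' : 0 < ε') (hε'1 : ε' ≤ 1)
    (hεε' : (G.seqs (some i)).card * ε ≤ (ε' / 2) ^ G.kappa i ∅)
    (hx : x ∈ G.plans i) (hpos : ∀ w ∈ G.seqs (some i), 0 < x w)
    (hratio : ∀ v ∈ G.seqs (some i), ∀ w ∈ G.seqs (some i), lossOf ℓ w < lossOf ℓ v →
      x v ≤ ε * x w) :
    ∃ d : ℕ → ℝ, (∀ l ∈ Finset.Icc 1 (G.kappa i ∅), 0 < d l ∧ d l ≤ ε') ∧
      x ∈ G.perturbedPlans i d ∧ ∀ z ∈ G.perturbedPlans i d, G.cost i ℓ x ≤ G.cost i ℓ z := by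
  obtain ⟨d, hd, hS, hcut⟩ :=
    exists_perturbSum_eq_sum_cut hG hℓ hε hε' hε'1 hεε' hx hpos hratio
  refine ⟨d, hd, mem_perturbedPlans_of_le_sum_cut hG hx hS fun w hw hw0 => (hcut w hw hw0).le,
    fun z hz => cost_le_cost hG hℓ fun t ht => ?_⟩
  obtain ⟨⟨w, hw, rfl⟩, hw0⟩ := mem_lossLevels.1 ht
  exact (hcut w hw hw0).symm.trans_le (perturbSum_le_sum_cut hG hℓ hz hw hw0)

end RatioToOptimal

section OptimalToRatio

variable {ε : ℝ} {d : ℕ → ℝ} {v w : MoveSet A} {x : MoveSet A → ℝ}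
  {ℓ : Finset (List A) × A → ℝ}

lemma le_quarter_of_card_mul_le (hε : 0 ≤ ε) (hεW : (G.seqs (some i)).card * ε ≤ 1 / 4) :
    ε ≤ 1 / 4 :=
  (le_mul_of_one_le_left hε (Nat.one_le_cast.2
    (Finset.card_pos.2 ⟨∅, empty_mem_seqs (some i)⟩))).trans hεW

lemma exists_weights_perturbSum (hG : G.PerfectRecall) (hℓ : G.IsLoss i ℓ) (hε : 0 ≤ ε)
    (hεW : (G.seqs (some i)).card * ε ≤ 1 / 4)
    (hd : ∀ l ∈ Finset.Icc 1 (G.kappa i ∅), 0 < d l ∧ d l ≤ ε) :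
    ∃ τ : MoveSet A → ℝ, ∑ v ∈ G.seqs (some i), τ v = 1 ∧
      (∀ w ∈ G.seqs (some i), G.perturbSum i d (G.lossRank i ℓ w - 1) ≤ τ w) ∧
      ∀ w ∈ G.seqs (some i), 0 < lossOf ℓ w →
        ∑ v ∈ G.seqs (some i) with lossOf ℓ w ≤ lossOf ℓ v, τ v =
          G.perturbSum i d (G.lossRank i ℓ w) := by
  have hε4 := le_quarter_of_card_mul_le hε hεW
  obtain ⟨F, hF, hFd, hF1, hgap⟩ := exists_monotone_extension_perturbSum hε hε4 hd
  obtain ⟨τ, hτ⟩ := exists_weights_of_cumulative (G.seqs (some i)) (G.lossRank i ℓ) hF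
    ((hFd 0 (kappa_pos ∅)).trans (perturbSum_zero d)).ge
  have hsum {w} (hw : w ∈ G.seqs (some i)) :
      ∑ v ∈ G.seqs (some i) with lossOf ℓ w ≤ lossOf ℓ v, τ v = F (G.lossRank i ℓ w) := by
    rw [← (hτ w hw).1, Finset.filter_congr fun v hv => lossRank_le_lossRank_iff hG hℓ hv hw]
  refine ⟨τ, ?_, fun w hw => ?_, fun w hw hw0 => ?_⟩
  · have hempty := hsum (empty_mem_seqs (some i))
    rwa [Finset.filter_true_of_mem fun v hv => lossOf_empty.trans_le (lossOf_nonneg hℓ hv),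
      lossRank_of_lossOf_eq_zero lossOf_empty, hF1] at hempty
  · obtain ⟨q, hq⟩ := Nat.exists_eq_add_one.2 (lossRank_pos (ℓ := ℓ) hw)
    have hqκ : q < G.kappa i ∅ := hq.ge.trans (lossRank_le_kappa hG hℓ hw)
    have hcard : (0 : ℝ) < (G.seqs (some i)).card := Nat.cast_pos.2 (Finset.card_pos.2 ⟨w, hw⟩)
    have hτw := (hτ w hw).2
    rw [hq, Nat.add_sub_cancel] at hτw ⊢
    refine le_of_mul_le_mul_left ?_ hcard
    calc (G.seqs (some i)).card * G.perturbSum i d q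
        ≤ (G.seqs (some i)).card * (2 * ε * G.perturb i d (q + 1)) :=
          mul_le_mul_of_nonneg_left (perturbSum_le hε (by linarith) hd hqκ) hcard.le
      _ = 2 * ((G.seqs (some i)).card * ε) * G.perturb i d (q + 1) := by ring
      _ ≤ 2 * (1 / 4) * G.perturb i d (q + 1) := by
          gcongr
          exact (perturb_pos (fun l hl => (hd l hl).1) _).le
      _ = G.perturb i d (q + 1) / 2 := by ring
      _ ≤ (G.seqs (some i)).card * τ w := (hgap q hqκ).trans hτw
  · rw [hsum hw, hFd _ (lossRank_lt_kappa hG hℓ hw hw0)]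

lemma sum_cut_eq_perturbSum_of_optimal (hG : G.PerfectRecall) (hℓ : G.IsLoss i ℓ) (hε : 0 ≤ ε)
    (hεW : (G.seqs (some i)).card * ε ≤ 1 / 4)
    (hd : ∀ l ∈ Finset.Icc 1 (G.kappa i ∅), 0 < d l ∧ d l ≤ ε) (hx : x ∈ G.perturbedPlans i d)
    (hopt : ∀ z ∈ G.perturbedPlans i d, G.cost i ℓ x ≤ G.cost i ℓ z)
    (hw : w ∈ G.seqs (some i)) (hw0 : 0 < lossOf ℓ w) :
    ∑ u ∈ G.cut i ℓ (lossOf ℓ w), x u = G.perturbSum i d (G.lossRank i ℓ w) := by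
  have hd0 : ∀ l ∈ Finset.Icc 1 (G.kappa i ∅), 0 < d l := fun l hl => (hd l hl).1
  obtain ⟨τ, hτ1, hτ, hτsum⟩ := exists_weights_perturbSum hG hℓ hε hεW hd
  -- The plan `y` is feasible and all its cut constraints bind, so `x` costs no more than `y`.
  obtain ⟨y, hy, hτy, hycut, hycost⟩ := exists_plan_of_weights hG hℓ
    (fun v hv => (perturbSum_nonneg hd0 _).trans (hτ v hv)) hτ1
  have hymem : y ∈ G.perturbedPlans i d := by
    refine mem_perturbedPlans_of_le_sum_cut (ℓ := ℓ) hG hy (fun v hv q hq => ?_) fun v hv hv0 => ?_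
    · exact (perturbSum_mono hd0 (Nat.le_sub_one_of_lt hq)).trans ((hτ v hv).trans (hτy v hv))
    · exact (hτsum v hv hv0).symm.trans_le (hycut _)
  rw [← hτsum w hw hw0]
  refine sum_cut_eq_of_cost_le_sum hG hℓ (fun t ht => ?_) (hycost ▸ hopt y hymem)
    (mem_lossLevels.2 ⟨⟨w, hw, rfl⟩, hw0⟩)
  obtain ⟨⟨v, hv, rfl⟩, hv0⟩ := mem_lossLevels.1 ht
  exact (hτsum v hv hv0).trans_le (perturbSum_le_sum_cut hG hℓ hx hv hv0)

lemma ratio_of_optimal (hG : G.PerfectRecall) (hℓ : G.IsLoss i ℓ) (hε : 0 ≤ ε)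
    (hεW : (G.seqs (some i)).card * ε ≤ 1 / 4)
    (hd : ∀ l ∈ Finset.Icc 1 (G.kappa i ∅), 0 < d l ∧ d l ≤ ε) (hx : x ∈ G.perturbedPlans i d)
    (hopt : ∀ z ∈ G.perturbedPlans i d, G.cost i ℓ x ≤ G.cost i ℓ z)
    (hv : v ∈ G.seqs (some i)) (hw : w ∈ G.seqs (some i)) (hwv : lossOf ℓ w < lossOf ℓ v) :
    x v ≤ 4 * ε * x w := by
  have hε4 := le_quarter_of_card_mul_le hε hεW
  have hd0 : ∀ l ∈ Finset.Icc 1 (G.kappa i ∅), 0 < d l := fun l hl => (hd l hl).1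
  have hv0 : 0 < lossOf ℓ v := (lossOf_nonneg hℓ hw).trans_lt hwv
  set n := G.lossRank i ℓ v
  set r := G.perturb i d (n + 1)
  have hr : 0 < r := perturb_pos hd0 _
  have hr1 : r ≤ 1 := perturb_le_one (fun l hl => ⟨hd0 l hl, (hd l hl).2.trans (by linarith)⟩) _
  have hcut : ∑ u ∈ G.cut i ℓ (lossOf ℓ v), x u ≤ 2 * ε * r :=
    (sum_cut_eq_perturbSum_of_optimal hG hℓ hε hεW hd hx hopt hv hv0).trans_le
      (perturbSum_le hε (by linarith) hd (lossRank_lt_kappa hG hℓ hv hv0))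
  have hrw : r ≤ x w + ∑ u ∈ G.cut i ℓ (lossOf ℓ v) with ¬ w ⊆ u, x u := by
    refine le_add_sum_cut hG hℓ hx.1 (cut_admissible hG hℓ hv0 hv le_rfl) hr1
      (fun E hE hlt => ?_) hw hwv
    calc r ≤ G.perturbSum i d (n + 1) := by
          rw [perturbSum_succ]
          exact le_add_of_nonneg_left (perturbSum_nonneg hd0 n)
      _ ≤ G.perturbSum i d (G.weight i E) := perturbSum_mono hd0 hlt
      _ ≤ ∑ u ∈ E, x u := hx.2 E hE
  have hrest : ∑ u ∈ G.cut i ℓ (lossOf ℓ v) with ¬ w ⊆ u, x u ≤ 2 * ε * r :=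
    (Finset.sum_le_sum_of_subset_of_nonneg (Finset.filter_subset _ _)
      fun u _ _ => plan_nonneg hG hx.1 u).trans hcut
  have hrx : r ≤ 2 * x w := by nlinarith
  calc x v ≤ 2 * ε * r := (le_sum_cut hG hx.1 hv le_rfl).trans hcut
    _ ≤ 2 * ε * (2 * x w) := by gcongr
    _ = 4 * ε * x w := by ring

end OptimalToRatio

end ExtensiveGame

/-! ### Comparison of the two notions -/

lemma eventually_forall_mul_le {ι : Type*} [Finite ι] (b : ι → ℝ) {c : ι → ℝ}
    (hc : ∀ i, 0 < c i) : ∀ᶠ ε in 𝓝[>] (0 : ℝ), ∀ i, b i * ε ≤ c i := by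
  refine eventually_all.2 fun i => nhdsWithin_le_nhds ?_
  have hcont : Continuous fun ε : ℝ => b i * ε := by fun_prop
  exact (hcont.tendsto' 0 0 (mul_zero _)).eventually_le_const (hc i)

namespace ExtensiveGame

variable {N A : Type*} [Fintype N] [DecidableEq N] [DecidableEq A] {G : ExtensiveGame N A}
  {ε ε' : ℝ} {γ : PlanProfile N A}

lemma IsEpsProperRatio.isEpsProperPerturbed (hG : G.PerfectRecall) (hε : 0 ≤ ε) (hε' : 0 < ε')
    (hε'1 : ε' ≤ 1)
    (hεε' : ∀ i, (G.seqs (some i)).card * ε ≤ (ε' / 2) ^ G.kappa i ∅)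
    (hγ : G.IsEpsProperRatio ε γ) : G.IsEpsProperPerturbed ε' γ := by
  obtain ⟨hplan, hpos, hratio⟩ := hγ
  have hperturb (i : N) : ∃ d : ℕ → ℝ,
      (∀ l ∈ Finset.Icc 1 (G.kappa i ∅), 0 < d l ∧ d l ≤ ε') ∧ γ i ∈ G.perturbedPlans i d ∧
      ∀ z ∈ G.perturbedPlans i d, G.objective i z γ ≤ G.objective i (γ i) γ := by
    obtain ⟨ℓ, hℓ, K, K', hobj, hmax⟩ := exists_isLoss_payoff hG i γ
    obtain ⟨d, hd, hmem, hopt⟩ := exists_perturbation_of_ratio hG hℓ hε hε' hε'1 (hεε' i)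
      (hplan i) (hpos i) fun v hv w hw hwv => hratio i v hv w hw <| by
        rw [hmax v hv, hmax w hw]
        exact sub_lt_sub_left hwv K'
    refine ⟨d, hd, hmem, fun z hz => ?_⟩
    rw [hobj z hz.1, hobj _ hmem.1]
    exact sub_le_sub_left (hopt z hz) K
  choose δ hδ hmem hopt using hperturb
  exact ⟨hplan, hpos, δ, hδ, fun i => ⟨hmem i, hopt i⟩⟩

lemma IsEpsProperPerturbed.isEpsProperRatio (hG : G.PerfectRecall) (hε : 0 ≤ ε)
    (hεW : ∀ i, (G.seqs (some i)).card * ε ≤ 1 / 4) (hγ : G.IsEpsProperPerturbed ε γ) :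
    G.IsEpsProperRatio (4 * ε) γ := by
  obtain ⟨hplan, hpos, δ, hδ, hnash⟩ := hγ
  refine ⟨hplan, hpos, fun i v hv w hw hvw => ?_⟩
  obtain ⟨ℓ, hℓ, K, K', hobj, hmax⟩ := exists_isLoss_payoff hG i γ
  obtain ⟨hmem, hopt⟩ := hnash i
  rw [hmax v hv, hmax w hw, sub_lt_sub_iff_left] at hvw
  refine ratio_of_optimal hG hℓ hε (hεW i) (hδ i) hmem (fun z hz => ?_) hv hw hvw
  have hz' := hopt z hz
  rwa [hobj z hz.1, hobj _ hmem.1, sub_le_sub_iff_left] at hz'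

lemma IsEpsProperRatio.mono (h : ε ≤ ε') (hγ : G.IsEpsProperRatio ε γ) :
    G.IsEpsProperRatio ε' γ :=
  ⟨hγ.1, hγ.2.1, fun i v hv w hw hvw => (hγ.2.2 i v hv w hw hvw).trans
    (mul_le_mul_of_nonneg_right h (hγ.2.1 i w hw).le)⟩

lemma IsEpsProperPerturbed.mono (h : ε ≤ ε') (hγ : G.IsEpsProperPerturbed ε γ) :
    G.IsEpsProperPerturbed ε' γ := by
  obtain ⟨hplan, hpos, δ, hδ, hnash⟩ := hγ
  exact ⟨hplan, hpos, δ, fun i l hl => ⟨(hδ i l hl).1, (hδ i l hl).2.trans h⟩, hnash⟩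

lemma eventually_isEpsProperPerturbed_of_ratio (hG : G.PerfectRecall) (hε' : 0 < ε') :
    ∀ᶠ ε in 𝓝[>] (0 : ℝ), ∀ γ, G.IsEpsProperRatio ε γ → G.IsEpsProperPerturbed ε' γ := by
  have hmin : 0 < min ε' 1 := lt_min hε' one_pos
  filter_upwards [self_mem_nhdsWithin,
    eventually_forall_mul_le _ fun i => pow_pos (half_pos hmin) (G.kappa i ∅)] with ε hε hεW γ hγ
  exact (hγ.isEpsProperPerturbed hG hε.le hmin (min_le_right _ _) hεW).mono (min_le_left _ _)

lemma eventually_isEpsProperRatio_of_perturbed (hG : G.PerfectRecall) (hε' : 0 < ε') :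
    ∀ᶠ ε in 𝓝[>] (0 : ℝ), ∀ γ, G.IsEpsProperPerturbed ε γ → G.IsEpsProperRatio ε' γ := by
  filter_upwards [self_mem_nhdsWithin,
    eventually_forall_mul_le (fun i => ((G.seqs (some i)).card : ℝ))
      fun _ => (by norm_num : (0 : ℝ) < 1 / 4),
    nhdsWithin_le_nhds (eventually_le_nhds (by positivity : 0 < ε' / 4))] with ε hε hεW hεε' γ hγ
  exact (hγ.isEpsProperRatio hG hε.le hεW).mono (by linarith)

end ExtensiveGame

/-! ### Limits -/

lemma mem_closure_of_mapClusterPt {X : Type*} [TopologicalSpace X] {P : ℝ → Set X}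
    (hP : Monotone P) {ε : ℕ → ℝ} (hε : Tendsto ε atTop (𝓝 0)) {η : ℕ → X}
    (hη : ∀ k, η k ∈ P (ε k)) {x : X} (hx : MapClusterPt x atTop η) {e : ℝ} (he : 0 < e) :
    x ∈ closure (P e) :=
  mem_closure_iff_clusterPt.2 <| ClusterPt.mono hx <| tendsto_principal.2 <|
    (hε.eventually_le_const he).mono fun k hk => hP hk (hη k)

namespace ExtensiveGame

variable {N A : Type*} [DecidableEq N] [DecidableEq A] {G : ExtensiveGame N A}
  {γ : PlanProfile N A}

lemma tendsto_of_forall_seqs (hγ : γ ∈ G.planProfiles) {η : ℕ → PlanProfile N A}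
    (hη : ∀ k, η k ∈ G.planProfiles)
    (h : ∀ k : ℕ, ∀ i, ∀ w ∈ G.seqs (some i), dist (η k i w) (γ i w) < 1 / ((k : ℝ) + 1)) :
    Tendsto η atTop (𝓝 γ) := by
  refine tendsto_pi_nhds.2 fun i => tendsto_pi_nhds.2 fun w => ?_
  by_cases hw : w ∈ G.seqs (some i)
  · exact tendsto_iff_dist_tendsto_zero.2 (squeeze_zero (fun _ => dist_nonneg)
      (fun k => (h k i w hw).le) tendsto_one_div_add_atTop_nhds_zero_nat)
  · simp only [(hη _ i).2.2.2 w hw, (hγ i).2.2.2 w hw]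
    exact tendsto_const_nhds

-- The product topology on all profiles need not be first countable, but plans vanish off the
-- finitely many sequences, so closure points in `planProfiles` are limits of sequences.
lemma exists_seq_tendsto_of_mem_closure [Finite N] {P : ℝ → Set (PlanProfile N A)}
    (hP : ∀ e, P e ⊆ G.planProfiles) (hγ : γ ∈ G.planProfiles)
    (hcl : ∀ e > 0, γ ∈ closure (P e)) :
    ∃ (ε : ℕ → ℝ) (η : ℕ → PlanProfile N A), (∀ k, 0 < ε k) ∧ Tendsto ε atTop (𝓝 0) ∧
      (∀ k, η k ∈ P (ε k)) ∧ Tendsto η atTop (𝓝 γ) := by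
  have hnear (k : ℕ) : ∀ᶠ ζ : PlanProfile N A in 𝓝 γ,
      ∀ i, ∀ w ∈ G.seqs (some i), dist (ζ i w) (γ i w) < 1 / ((k : ℝ) + 1) := by
    refine eventually_all.2 fun i => (Finset.eventually_all _).2 fun w _ => ?_
    have hcont : Continuous fun ζ : PlanProfile N A => ζ i w := by fun_prop
    exact hcont.continuousAt.eventually (Metric.ball_mem_nhds _ Nat.one_div_pos_of_nat)
  have hex (k : ℕ) : ∃ ζ ∈ P (1 / ((k : ℝ) + 1)),
      ∀ i, ∀ w ∈ G.seqs (some i), dist (ζ i w) (γ i w) < 1 / ((k : ℝ) + 1) :=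
    ((mem_closure_iff_frequently.1 (hcl _ Nat.one_div_pos_of_nat)).and_eventually
      (hnear k)).exists
  choose η hη hdist using hex
  exact ⟨_, η, fun _ => Nat.one_div_pos_of_nat, tendsto_one_div_add_atTop_nhds_zero_nat, hη,
    tendsto_of_forall_seqs hγ (fun k => hP _ (hη k)) hdist⟩

variable [Fintype N]

lemma isProperRatio_iff : G.IsProperRatio γ ↔
    γ ∈ G.planProfiles ∧ ∀ e > 0, γ ∈ closure {ζ | G.IsEpsProperRatio e ζ} := by
  refine and_congr_right fun hγ => ⟨?_, fun hcl => ?_⟩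
  · rintro ⟨ε, η, -, hε, hη, hlim⟩ e he
    exact mem_closure_of_mapClusterPt (P := fun e => {ζ | G.IsEpsProperRatio e ζ})
      (fun _ _ h _ hζ => IsEpsProperRatio.mono h hζ) hε hη hlim he
  · obtain ⟨ε, η, hε, hε0, hη, hlim⟩ :=
      exists_seq_tendsto_of_mem_closure (fun _ _ hζ => hζ.1) hγ hcl
    exact ⟨ε, η, hε, hε0, hη, hlim.mapClusterPt⟩

lemma isProperPerturbed_iff : G.IsProperPerturbed γ ↔
    γ ∈ G.planProfiles ∧ ∀ e > 0, γ ∈ closure {ζ | G.IsEpsProperPerturbed e ζ} := by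
  refine and_congr_right fun hγ => ⟨?_, fun hcl => ?_⟩
  · rintro ⟨ε, η, -, hε, hη, hlim⟩ e he
    exact mem_closure_of_mapClusterPt (P := fun e => {ζ | G.IsEpsProperPerturbed e ζ})
      (fun _ _ h _ hζ => IsEpsProperPerturbed.mono h hζ) hε hη hlim.mapClusterPt he
  · exact exists_seq_tendsto_of_mem_closure (fun _ _ hζ => hζ.1) hγ hcl

end ExtensiveGame

end

theorem theorem3 {N A : Type*} [Fintype N] [DecidableEq N] [DecidableEq A]
    (G : ExtensiveGame N A) (hG : G.PerfectRecall) (γ : PlanProfile N A) :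
    G.IsProperRatio γ ↔ G.IsProperPerturbed γ := by
  rw [ExtensiveGame.isProperRatio_iff, ExtensiveGame.isProperPerturbed_iff]
  refine and_congr_right fun _ => ⟨fun hcl ε' hε' => ?_, fun hcl ε' hε' => ?_⟩
  · obtain ⟨ε, himp, hε⟩ := ((ExtensiveGame.eventually_isEpsProperPerturbed_of_ratio hG hε').and
      self_mem_nhdsWithin).exists
    exact closure_mono himp (hcl ε hε)
  · obtain ⟨ε, himp, hε⟩ := ((ExtensiveGame.eventually_isEpsProperRatio_of_perturbed hG hε').and
      self_mem_nhdsWithin).exists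
    exact closure_mono himp (hcl ε hε)
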